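/- **Setting.** Let $f:\mathbb R^d\times\mathcal Z\to\mathbb R$, let $\mathcal D$ be a probability distribution on $\mathcal Z$, and let $F(x)=\mathbb E_{z\sim\mathcal D}f(x,z)$ be (finite and) bounded below, $F^\star=\inf_x F(x)$. Assume that every $f(\cdot,z)$ is differentiable with $L$-Lipschitz gradient ($L>0$), and that for all $x$ and all coordinates $k$ the variable $X=\partial_kf(x,z)-\partial_kF(x)$ is sub-gamma with variance factor $\sigma$ and scale $a\ge0$: $\log\mathbb E_{z\sim\mathcal D}[e^{\lambda X}]\le\frac{\lambda^2\sigma^2}{2(1-a|\lambda|)}$ for $a|\lambda|<1$. Each of $N$ agents holds $b$ fixed samples $z_i^1,\dots,z_i^b$ (SAA setting), all $Nb$ samples being i.i.d. from $\mathcal D$; put $F_i(x)=\frac1b\sum_jf(x,z_i^j)$. In every round each agent is trustworthy or Byzantine. The states of the agents evolve as independent two-state Markov chains with trustworthy-to-Byzantine probability $p_b$ and Byzantine-to-trustworthy probability $p_t$, $0<p_b<p_t<1$, with arbitrary initial law, independent of the samples. In round $t$ agent $i$ reports $g_{i,t}=\nabla F_i(x_t)$ if it is trustworthy and an arbitrary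 vector if it is Byzantine; the adversary may know everything except the future state transitions (given the past, these follow the Markov chains). **Algorithm (RANGE on $\mathbb R^d$).** Let $m\ge1$, $m_0\ge0$, $\alpha_1,\alpha_2\in[0,\frac12)$ with $\alpha_1m,\alpha_2N\in\mathbb N_0$. The robust mean with threshold $\alpha$ of $k$ vectors is, in each coordinate, the mean of the $(1-\alpha)k$ entries nearest to the median. Start at a fixed $x_1$. For $t=1,\dots,T+m-1+m_0$: for each $i$ set $\hat g_{i,t}=g_{i,t}$ if $t<m$, otherwise let $\hat g_{i,t}$ be the robust mean of $g_{i,t},\dots,g_{i,t-m+1}$ with threshold $\alpha_1$; let $\hat{\hat g}_t$ be the robust mean of $\hat g_{1,t},\dots,\hat g_{N,t}$ with threshold $\alpha_2$; put $x_{t+1}=x_t-\gamma\,\hat{\hat g}_t/\|\hat{\hat g}_t\|$ (with $0/\|0\|=0$). **Failure probability.** Let $Z_t=1$ if for more than $\alpha_2N$ agents more than $\alpha_1m$ of the states at times $t-m+1,\dots,t$ are Byzantine, and $Z_t=0$ otherwise. Let $P_Z=P_Z^m(m_0)$ be any upper bound, uniform in the joint state $w$, on the conditional probability that $Z_t=1$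 given that the agents' joint state at time $t-m+1-m_0$ is $w$ (for example the maximum over $w$). **Theorem.** Let $\gamma=\gamma_0/\sqrt T$ with $\gamma_0>0$, and suppose $P_Z<1/2$. Then for all $T,N,b\ge1$ $$\frac1T\sum_{t=m+m_0}^{T+m-1+m_0}\mathbb E\|\nabla F(x_t)\|\le\frac{F(x_1)-F^\star}{\sqrt T\,\gamma_0(1-2P_Z)}+\frac{\overline C\gamma_0}{\sqrt T}+R_T+\frac{K\,(1+\log(TNb))}{1-2P_Z}\left(\frac1{\sqrt{Nb}}+\frac{C_{\alpha_2}}{\sqrt b}\right),$$ where $$C_\alpha=\tfrac{2\alpha}{1-\alpha}\Big(1+\sqrt{\tfrac{(1-\alpha)^2}{1-2\alpha}}\Big)\sqrt d,$$ $$\overline C=\frac{L}{1-2P_Z}\Big(\tfrac12+4(m-1+m_0)P_Z+2(m-1)\big(1+C_{\alpha_1}+2C_{\alpha_2}(C_{\alpha_1}+1)\big)\Big),$$ $$R_T=\frac{\|\nabla F(x_1)\|(m-1+m_0)}{T(1-2P_Z)}+\frac{L\gamma_0(m-1+m_0)^2}{2T^{3/2}(1-2P_Z)}=O(1/T),$$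 and the constant $K$ depends only on $d,L,\sigma,a,\gamma_0,m,m_0$. Consequently some iterate $x_t$ with $m+m_0\le t\le T+m-1+m_0$ has $\mathbb E\|\nabla F(x_t)\|$ at most the same right-hand side, which is $O(1/\sqrt T)$ plus the statistical error. -/

import Mathlib

open MeasureTheory ProbabilityTheory

noncomputable section

/-! ### Smoothness, risk, and the noise assumption -/

/-- `h` is differentiable on `ℝ^d` with an `L`-Lipschitz gradient. -/
def IsLSmooth {d : ℕ} (L : ℝ) (h : EuclideanSpace ℝ (Fin d) → ℝ) : Prop :=
  Differentiable ℝ h ∧ ∀ x y, ‖gradient h x - gradient h y‖ ≤ L * ‖x - y‖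

/-- The population risk `F(x) = 𝔼_{z ∼ D} f(x, z)`. -/
def risk {d : ℕ} {S : Type*} [MeasurableSpace S] (D : Measure S)
    (f : EuclideanSpace ℝ (Fin d) → S → ℝ) (x : EuclideanSpace ℝ (Fin d)) : ℝ :=
  ∫ z, f x z ∂D

/-- The empirical risk of one agent that holds the `b` samples `z 0, …, z (b-1)`. -/
def empiricalRisk {d b : ℕ} {S : Type*} (f : EuclideanSpace ℝ (Fin d) → S → ℝ)
    (z : Fin b → S) (x : EuclideanSpace ℝ (Fin d)) : ℝ :=
  (1 / (b : ℝ)) * ∑ j, f x (z j)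

/-- Under `D`, the variable `X` is sub-gamma with variance factor `σ` and scale parameter `a`:
`log 𝔼 exp(lX) ≤ l² σ² / (2 (1 - a|l|))` whenever `a|l| < 1` (that is `|l| < 1/a`, and every `l`
if `a = 0`). The moment generating function is required to be finite there. -/
def IsSubGamma {S : Type*} [MeasurableSpace S] (D : Measure S) (σ a : ℝ) (X : S → ℝ) : Prop :=
  ∀ l : ℝ, a * |l| < 1 →
    Integrable (fun z => Real.exp (l * X z)) D ∧
      Real.log (∫ z, Real.exp (l * X z) ∂D) ≤ l ^ 2 * σ ^ 2 / (2 * (1 - a * |l|))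

/-- All coordinates of the gradient noise `∇f(x, z) - ∇F(x)`, at all points `x`, are sub-gamma. -/
def HasSubGammaNoise {d : ℕ} {S : Type*} [MeasurableSpace S] (D : Measure S) (σ a : ℝ)
    (f : EuclideanSpace ℝ (Fin d) → S → ℝ) : Prop :=
  ∀ (x : EuclideanSpace ℝ (Fin d)) (k : Fin d),
    IsSubGamma D σ a (fun z => gradient (fun y => f y z) x k - gradient (risk D f) x k)

/-! ### The robust mean estimator -/

/-- `c` is a median of the numbers `v 0, …, v (k-1)`: at least half of them are `≤ c` and at least
half of them are `≥ c` (for even `k`, the midpoint of the two middle values is one such `c`). -/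
def IsMedian {k : ℕ} (v : Fin k → ℝ) (c : ℝ) : Prop :=
  k ≤ 2 * (Finset.univ.filter fun i => v i ≤ c).card ∧
    k ≤ 2 * (Finset.univ.filter fun i => c ≤ v i).card

/-- `vhat` is an output of the median-based robust mean estimator with threshold `α` on the vectors
`v 0, …, v (k-1)`: each coordinate of `vhat` is the mean of the `(1-α)k` entries nearest to the
median of that coordinate, ties being broken arbitrarily. -/
def IsRobustMean {d k : ℕ} (α : ℝ) (v : Fin k → EuclideanSpace ℝ (Fin d))
    (vhat : EuclideanSpace ℝ (Fin d)) : Prop :=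
  ∀ j : Fin d, ∃ c : ℝ, IsMedian (fun i => v i j) c ∧
    ∃ I : Finset (Fin k), (I.card : ℝ) = (1 - α) * k ∧
      (∀ i ∈ I, ∀ i' ∉ I, |v i j - c| ≤ |v i' j - c|) ∧
      vhat j = (1 / ((1 - α) * k)) * ∑ i ∈ I, v i j

/-! ### The agents' Markov chains

The state of an agent is `false` (trustworthy) or `true` (Byzantine). -/

/-- Entries of the two-state transition matrix. -/
def agentTrans (pb pt : ℝ) : Bool → Bool → ℝ
  | false, false => 1 - pb
  | false, true => pb
  | true, false => pt
  | true, true => 1 - pt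

/-- The agents' joint state `W t` is adapted to `𝓕` and, given everything that happened up to
time `t ≥ 1`, the agents move independently of each other according to `agentTrans pb pt`.
The law of the state at time `1` is arbitrary. -/
def IsAgentChain {Ω : Type*} {mΩ : MeasurableSpace Ω} {N : ℕ} (μ : Measure Ω)
    (𝓕 : Filtration ℕ mΩ) (pb pt : ℝ) (W : ℕ → Ω → Fin N → Bool) : Prop :=
  (∀ t, Measurable[𝓕 t] (W t)) ∧
    ∀ t, 1 ≤ t → ∀ w : Fin N → Bool,
      μ[(W (t + 1) ⁻¹' {w}).indicator (fun _ => (1 : ℝ)) | 𝓕 t]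
        =ᵐ[μ] fun ω => ∏ i, agentTrans pb pt (W t ω i) (w i)

/-- Temporal averaging of one agent fails on a window of `m` states:
more than `α₁ m` of them are Byzantine. -/
def TemporalFails {m : ℕ} (α₁ : ℝ) (u : Fin m → Bool) : Prop :=
  α₁ * m < ((Finset.univ.filter fun τ => u τ = true).card : ℝ)

open Classical in
/-- Robust aggregation fails on a window of `m` joint states:
temporal averaging fails for more than `α₂ N` agents. -/
def AggregationFails {m N : ℕ} (α₁ α₂ : ℝ) (u : Fin m → Fin N → Bool) : Prop :=
  α₂ * N < ((Finset.univ.filter fun i => TemporalFails α₁ fun τ => u τ i).card : ℝ)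

/-- Probability of the trajectory `u` of the `N` independent chains, given its first state. -/
def pathProb {n N : ℕ} (pb pt : ℝ) (u : Fin (n + 1) → Fin N → Bool) : ℝ :=
  ∏ k : Fin n, ∏ i, agentTrans pb pt (u k.castSucc i) (u k.succ i)

open Classical in
/-- Probability that aggregation fails on the window of times `s + m₀, …, s + m₀ + m - 1`,
given that the joint state at time `s` is `w`. -/
def failProb (m m₀ : ℕ) {N : ℕ} (α₁ α₂ pb pt : ℝ) (w : Fin N → Bool) : ℝ :=
  ∑ u : Fin (m₀ + m - 1 + 1) → Fin N → Bool,
    if u 0 = w ∧ AggregationFails α₁ α₂ (fun τ : Fin m => u ⟨m₀ + τ, by omega⟩)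
    then pathProb pb pt u else 0

/-- `P` bounds the conditional failure probability, uniformly in the state conditioned on. -/
def IsUniformFailBound (m m₀ N : ℕ) (α₁ α₂ pb pt P : ℝ) : Prop :=
  ∀ w : Fin N → Bool, failProb m m₀ α₁ α₂ pb pt w ≤ P

/-! ### The algorithm -/

/-- One run of RANGE on `ℝ^d` for the rounds `t = 1, …, H`, with agents' states `w t i`, honest
gradients `honest i`, received feedback `g t i` (unrestricted when the agent is Byzantine),
robustified gradients `ghat t i`, aggregates `agg t`, and iterates `x t`. As `‖0‖⁻¹ • 0 = 0`, the
normalization of the zero vector is zero. -/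
structure IsRangeRun {d N : ℕ} (m H : ℕ) (α₁ α₂ γ : ℝ) (x₁ : EuclideanSpace ℝ (Fin d))
    (honest : Fin N → EuclideanSpace ℝ (Fin d) → EuclideanSpace ℝ (Fin d))
    (w : ℕ → Fin N → Bool) (g ghat : ℕ → Fin N → EuclideanSpace ℝ (Fin d))
    (agg x : ℕ → EuclideanSpace ℝ (Fin d)) : Prop where
  init : x 1 = x₁
  feedback : ∀ t, 1 ≤ t → t ≤ H → ∀ i, w t i = false → g t i = honest i (x t)
  early : ∀ t, 1 ≤ t → t ≤ H → t < m → ∀ i, ghat t i = g t i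
  temporal : ∀ t, 1 ≤ t → t ≤ H → m ≤ t → ∀ i,
    IsRobustMean α₁ (fun τ : Fin m => g (t - τ) i) (ghat t i)
  aggregate : ∀ t, 1 ≤ t → t ≤ H → IsRobustMean α₂ (ghat t) (agg t)
  step : ∀ t, 1 ≤ t → t ≤ H → x (t + 1) = x t - γ • (‖agg t‖⁻¹ • agg t)

/-! ### The constants of the bound -/

/-- `C_α = (2α/(1-α)) (1 + √((1-α)²/(1-2α))) √d`. -/
def Calpha (d : ℕ) (α : ℝ) : ℝ :=
  2 * α / (1 - α) * (1 + √((1 - α) ^ 2 / (1 - 2 * α))) * √(d : ℝ)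

/-- `C̄ = L/(1-2P) (1/2 + 4(m-1+m₀)P + 2(m-1)(1 + C_{α₁} + 2C_{α₂}(C_{α₁}+1)))`. -/
def Cbar (d m m₀ : ℕ) (L α₁ α₂ P : ℝ) : ℝ :=
  L / (1 - 2 * P) *
    (1 / 2 + 4 * ((m : ℝ) - 1 + m₀) * P
      + 2 * ((m : ℝ) - 1) *
        (1 + Calpha d α₁ + 2 * Calpha d α₂ * (Calpha d α₁ + 1)))

/-- The bound on the averaged expected gradient norm. `gap` is `F(x₁) - F*`, `G₁` is `‖∇F(x₁)‖`.
Its lines are the optimization error, the `O(1/T)` term, and the statistical error with hidden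
constant `K` and hidden logarithm. -/
def rangeBound (d m m₀ N b T : ℕ) (L γ₀ α₁ α₂ P gap G₁ K : ℝ) : ℝ :=
  gap / (√(T : ℝ) * γ₀ * (1 - 2 * P)) + Cbar d m m₀ L α₁ α₂ P * γ₀ / √(T : ℝ)
    + (G₁ * ((m : ℝ) - 1 + m₀) / (T * (1 - 2 * P))
      + L * γ₀ * ((m : ℝ) - 1 + m₀) ^ 2 / (2 * (T * √(T : ℝ)) * (1 - 2 * P)))
    + K / (1 - 2 * P) * (1 + Real.log (T * N * b))
      * (1 / √((N : ℝ) * b) + Calpha d α₂ / √(b : ℝ))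

end

/-! A normalized step has length at most `γ` whatever the adversary reports. Write `G` for the
gradient of `F` at the current iterate and `a` for the aggregate. The inner product of `G` with the
direction of `a` is at least `‖G‖ - 2‖a - G‖` (`norm_sub_two_mul_le_inner_normalize`), so a round
with aggregation error `e` lowers `F` by at least `γ‖G‖ - 2γe - Lγ²/2`. A round in which aggregation
fails raises `F` by at most `γ‖G‖ + Lγ²/2`. Both cases take the form: `γ‖G‖` is at most the decrease
of `F`, plus `2γ‖G‖` if the round fails, plus an error (`IsRangeRun.step_le`). The decreases
telescope.

The failure event and the current iterate are dependent. Going back `m - 1 + m₀` rounds decouples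
them: the old iterate is known before the transitions that decide the failure, so conditioning gives
a factor `P` (`IsAgentChain.integral_fails_le`), and smoothness pays for replacing one iterate by
the other and back. The resulting term `2γP 𝔼‖G‖` moves to the left, which is where `P < 1/2` enters
(`sum_integral_norm_gradient_le`).

In a good round the error has three sources (`IsRangeRun.norm_agg_sub_le`): gradients up to `m - 1`
rounds old, the noise averaged over all `Nb` samples, and the noise of single agents. The last is
weighted by `Calpha d α₂`, because a robust mean differs from an honest mean by only a few swapped
entries (`abs_sum_nearest_sub_sum_le`).

The adversary may steer the iterates using the samples, so the noise is bounded at all points of a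
ball that contains the run (`exists_noise_envelope`). A grid and the Lipschitz property reduce this
to finitely many exponential moments, at the price of a logarithm. -/

/-! ### Smooth functions and the population risk -/

section Smooth

open Filter Topology

variable {d : ℕ}

/-- First-order Taylor bound for a function with Lipschitz gradient. -/
theorem IsLSmooth.abs_taylor_le {L : ℝ} {h : EuclideanSpace ℝ (Fin d) → ℝ} (hh : IsLSmooth L h)
    (x y : EuclideanSpace ℝ (Fin d)) :
    |h y - h x - inner ℝ (gradient h x) (y - x)| ≤ L / 2 * ‖y - x‖ ^ 2 := by
  obtain ⟨hd, hL⟩ := hh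
  set v := y - x with hv
  have hline : ∀ s : ℝ, HasDerivAt (fun s : ℝ => x + s • v) v s := fun s => by
    simpa using ((hasDerivAt_id s).smul_const v).const_add x
  have hder : ∀ s : ℝ, HasDerivAt (fun s : ℝ => h (x + s • v) - h x - s * inner ℝ (gradient h x) v)
      (inner ℝ (gradient h (x + s • v) - gradient h x) v) s := fun s => by
    have h1 := ((hd (x + s • v)).hasGradientAt.hasFDerivAt).comp_hasDerivAt s (hline s)
    have h2 := (h1.sub_const (h x)).sub
      ((hasDerivAt_id s).mul_const (inner ℝ (gradient h x) v))
    rw [inner_sub_left]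
    rw [one_mul] at h2
    exact h2
  have hB : ∀ s : ℝ, HasDerivAt (fun s : ℝ => L / 2 * ‖v‖ ^ 2 * s ^ 2) (L * s * ‖v‖ ^ 2) s :=
    fun s => by
      have h := (hasDerivAt_pow 2 s).const_mul (L / 2 * ‖v‖ ^ 2)
      have e : L / 2 * ‖v‖ ^ 2 * (((2 : ℕ) : ℝ) * s ^ (2 - 1)) = L * s * ‖v‖ ^ 2 := by
        norm_num; ring
      rwa [e] at h
  -- Along the segment the remainder vanishes at `0` and its derivative at `s` is at most `L s
  -- ‖v‖²`; comparison with the primitive of this bound replaces integration.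
  have key := image_norm_le_of_norm_deriv_right_le_deriv_boundary (a := 0) (b := 1)
    (fun s _ => (hder s).continuousAt.continuousWithinAt)
    (fun s _ => (hder s).hasDerivWithinAt) (by simp) hB
    (fun s hs => by
      refine (norm_inner_le_norm _ _).trans ?_
      have h1 := hL (x + s • v) x
      rw [add_sub_cancel_left, norm_smul, Real.norm_of_nonneg hs.1] at h1
      nlinarith [norm_nonneg v])
    (Set.right_mem_Icc.2 zero_le_one)
  have hxy : x + v = y := by rw [hv]; abel
  simpa [hxy] using key

theorem hasGradientAt_of_abs_le {h : EuclideanSpace ℝ (Fin d) → ℝ}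
    {x G : EuclideanSpace ℝ (Fin d)} {C : ℝ}
    (hh : ∀ y, |h y - h x - inner ℝ G (y - x)| ≤ C * ‖y - x‖ ^ 2) : HasGradientAt h G x := by
  rw [hasGradientAt_iff_isLittleO]
  have h1 : (fun y => h y - h x - inner ℝ G (y - x)) =O[𝓝 x] fun y => ‖y - x‖ ^ 2 :=
    Asymptotics.IsBigO.of_bound C (Eventually.of_forall fun y => by
      simpa using hh y)
  refine h1.trans_isLittleO ?_
  have h2 : (fun y : EuclideanSpace ℝ (Fin d) => ‖y - x‖ ^ 2) =o[𝓝 x] fun y => y - x := by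
    have := (Asymptotics.isLittleO_norm_pow_id (E' := EuclideanSpace ℝ (Fin d)) one_lt_two)
    have ht : Tendsto (fun y : EuclideanSpace ℝ (Fin d) => y - x) (𝓝 x) (𝓝 0) := by
      simpa using (continuous_sub_right x).tendsto x
    exact this.comp_tendsto ht
  exact h2

variable {S : Type*} [MeasurableSpace S] {D : Measure S}
  {f : EuclideanSpace ℝ (Fin d) → S → ℝ} {L : ℝ}

/-- Measurability comes from difference quotients of the integrable functions `f x`; the Taylor
bound dominates the directional derivative by `|f (x + v) z - f x z| + L/2 ‖v‖²`. -/
theorem integrable_inner_gradient [IsProbabilityMeasure D] (hf : ∀ x, Integrable (f x) D)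
    (hL : ∀ z, IsLSmooth L fun x => f x z) (x v : EuclideanSpace ℝ (Fin d)) :
    Integrable (fun z => inner ℝ (gradient (fun y => f y z) x) v) D := by
  have hmeas : AEStronglyMeasurable (fun z => inner ℝ (gradient (fun y => f y z) x) v) D := by
    refine aestronglyMeasurable_of_tendsto_ae atTop
      (f := fun (n : ℕ) z => ((n : ℝ) + 1) * (f (x + ((n : ℝ) + 1)⁻¹ • v) z - f x z))
      (fun n => (((hf _).sub (hf _)).const_mul _).aestronglyMeasurable)
      (Eventually.of_forall fun z => ?_)
    have h1 := (((hL z).1 x).hasGradientAt).hasFDerivAt.hasLineDerivAt v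
    have h2 : Tendsto (fun n : ℕ => ((n : ℝ) + 1)⁻¹) atTop (𝓝[≠] 0) := by
      refine tendsto_nhdsWithin_of_tendsto_nhds_of_eventually_within _ ?_
        (Eventually.of_forall fun n => by
          have : (0 : ℝ) < n + 1 := by positivity
          exact (inv_pos.2 this).ne')
      simpa using tendsto_one_div_add_atTop_nhds_zero_nat (𝕜 := ℝ)
    have h3 := (h1.tendsto_slope_zero).comp h2
    simpa [Function.comp_def] using h3
  refine Integrable.mono'
    ((((hf (x + v)).sub (hf x)).abs).add (integrable_const (L / 2 * ‖v‖ ^ 2))) hmeas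
    (Eventually.of_forall fun z => ?_)
  have h1 := (hL z).abs_taylor_le x (x + v)
  simp only [add_sub_cancel_left] at h1
  rw [Real.norm_eq_abs, Pi.add_apply]
  have h2 := abs_le.1 h1
  have h3 := neg_abs_le (f (x + v) z - f x z)
  have h4 := le_abs_self (f (x + v) z - f x z)
  change _ ≤ |f (x + v) z - f x z| + L / 2 * ‖v‖ ^ 2
  rw [abs_le]
  constructor <;> linarith

theorem integrable_gradient [IsProbabilityMeasure D] (hf : ∀ x, Integrable (f x) D)
    (hL : ∀ z, IsLSmooth L fun x => f x z) (x : EuclideanSpace ℝ (Fin d)) :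
    Integrable (fun z => gradient (fun y => f y z) x) D := by
  refine Integrable.of_eval_piLp fun k => ?_
  have h := integrable_inner_gradient hf hL x (EuclideanSpace.single k (1 : ℝ))
  simp_rw [EuclideanSpace.inner_single_right] at h
  simpa only [conj_trivial, one_mul] using h

/-- The quadratic Taylor bound is uniform in `z`, so it survives integration and identifies the
gradient directly, without differentiating under the integral. -/
theorem hasGradientAt_risk [IsProbabilityMeasure D] (hf : ∀ x, Integrable (f x) D)
    (hL : ∀ z, IsLSmooth L fun x => f x z) (x : EuclideanSpace ℝ (Fin d)) :
    HasGradientAt (risk D f) (∫ z, gradient (fun y => f y z) x ∂D) x := by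
  refine hasGradientAt_of_abs_le (C := L / 2) fun y => ?_
  have hint := integrable_inner_gradient hf hL x (y - x)
  have h1 : inner ℝ (∫ z, gradient (fun y => f y z) x ∂D) (y - x)
      = ∫ z, inner ℝ (gradient (fun y => f y z) x) (y - x) ∂D := by
    rw [real_inner_comm, ← integral_inner (integrable_gradient hf hL x)]
    simp_rw [real_inner_comm]
  have h2 : risk D f y - risk D f x - inner ℝ (∫ z, gradient (fun y => f y z) x ∂D) (y - x)
      = ∫ z, (f y z - f x z - inner ℝ (gradient (fun y => f y z) x) (y - x)) ∂D := by
    rw [h1, risk, risk, ← integral_sub (hf y) (hf x)]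
    exact (integral_sub ((hf y).sub (hf x)) hint).symm
  rw [h2, ← Real.norm_eq_abs]
  have h3 := norm_integral_le_of_norm_le_const (μ := D)
    (f := fun z => f y z - f x z - inner ℝ (gradient (fun y => f y z) x) (y - x))
    (C := L / 2 * ‖y - x‖ ^ 2)
    (Eventually.of_forall fun z => (hL z).abs_taylor_le x y)
  simpa using h3

theorem isLSmooth_risk [IsProbabilityMeasure D] (hf : ∀ x, Integrable (f x) D)
    (hL : ∀ z, IsLSmooth L fun x => f x z) : IsLSmooth L (risk D f) := by
  refine ⟨fun x => (hasGradientAt_risk hf hL x).differentiableAt, fun x y => ?_⟩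
  rw [(hasGradientAt_risk hf hL x).gradient, (hasGradientAt_risk hf hL y).gradient,
    ← integral_sub (integrable_gradient hf hL x) (integrable_gradient hf hL y)]
  have h3 := norm_integral_le_of_norm_le_const (μ := D)
    (f := fun z => gradient (fun y => f y z) x - gradient (fun y => f y z) y)
    (C := L * ‖x - y‖) (Eventually.of_forall fun z => (hL z).2 x y)
  simpa using h3

theorem gradient_empiricalRisk {S : Type*} {f : EuclideanSpace ℝ (Fin d) → S → ℝ} {b : ℕ}
    (hL : ∀ z, IsLSmooth L fun x => f x z) (z : Fin b → S)
    (x : EuclideanSpace ℝ (Fin d)) :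
    gradient (empiricalRisk f z) x
      = (1 / (b : ℝ)) • ∑ j, gradient (fun y => f y (z j)) x := by
  refine HasGradientAt.gradient ?_
  rw [hasGradientAt_iff_hasFDerivAt]
  have h1 : HasFDerivAt (fun y => ∑ j, f y (z j)) (∑ j, (InnerProductSpace.toDual ℝ _
      (gradient (fun y => f y (z j)) x) : StrongDual ℝ (EuclideanSpace ℝ (Fin d)))) x :=
    HasFDerivAt.fun_sum fun j _ => (((hL (z j)).1 x).hasGradientAt).hasFDerivAt
  have h2 := h1.const_mul (1 / (b : ℝ))
  rw [map_smulₛₗ, map_sum]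
  exact h2

end Smooth

/-! ### Uniform control of the sampling noise -/

section Noise

open Real

theorem EuclideanSpace.norm_le_sqrt_mul {d : ℕ} {v : EuclideanSpace ℝ (Fin d)} {c : ℝ}
    (hc : 0 ≤ c) (hv : ∀ k, |v k| ≤ c) : ‖v‖ ≤ √(d : ℝ) * c := by
  rw [EuclideanSpace.norm_eq]
  refine Real.sqrt_le_iff.2 ⟨by positivity, ?_⟩
  rw [mul_pow, Real.sq_sqrt (Nat.cast_nonneg d)]
  calc ∑ i, ‖v i‖ ^ 2 ≤ ∑ _i : Fin d, c ^ 2 :=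
        Finset.sum_le_sum fun i _ => pow_le_pow_left₀ (norm_nonneg _) (hv i) 2
    _ = d * c ^ 2 := by simp

theorem EuclideanSpace.abs_apply_le_norm {d : ℕ} (v : EuclideanSpace ℝ (Fin d)) (k : Fin d) :
    |v k| ≤ ‖v‖ := by
  simpa using PiLp.norm_apply_le v k

/-- A ball of radius `R` has a grid of at most `(2⌈R/δ⌉ + 1) ^ d` points at distance `√d δ`. -/
theorem exists_grid {d : ℕ} (x₁ : EuclideanSpace ℝ (Fin d)) (R : ℝ) {δ : ℝ} (hδ : 0 < δ) :
    ∃ t : Finset (EuclideanSpace ℝ (Fin d)), t.card ≤ (2 * ⌈R / δ⌉₊ + 1) ^ d ∧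
      ∀ x, ‖x - x₁‖ ≤ R → ∃ y ∈ t, ‖x - y‖ ≤ √(d : ℝ) * δ := by
  classical
  set n : ℕ := ⌈R / δ⌉₊ with hn
  refine ⟨(Fintype.piFinset fun _ : Fin d => Finset.Icc (-(n : ℤ)) n).image
    fun p => x₁ + WithLp.toLp 2 fun k => δ * (p k : ℝ), ?_, fun x hx => ?_⟩
  · refine Finset.card_image_le.trans ?_
    rw [Fintype.card_piFinset]
    simp only [Int.card_Icc, Finset.prod_const, Finset.card_univ, Fintype.card_fin]
    exact Nat.pow_le_pow_left (by omega) d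
  -- Rounding down errs by at most `δ` in each coordinate.
  · refine ⟨_, Finset.mem_image.2 ⟨fun k => ⌊(x - x₁) k / δ⌋, ?_, rfl⟩, ?_⟩
    · refine Fintype.mem_piFinset.2 fun k => Finset.mem_Icc.2 ?_
      have h1 : |(x - x₁) k / δ| ≤ n := by
        rw [abs_div, abs_of_pos hδ]
        exact ((div_le_div_iff_of_pos_right hδ).2
          ((EuclideanSpace.abs_apply_le_norm _ k).trans hx)).trans (Nat.le_ceil _)
      obtain ⟨h2, h3⟩ := abs_le.1 h1
      refine ⟨Int.le_floor.2 (by push_cast; exact h2), ?_⟩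
      have h4 := (Int.floor_le ((x - x₁) k / δ)).trans h3
      refine (Int.cast_le (R := ℝ)).1 ?_
      rw [Int.cast_natCast]
      exact h4
    · refine EuclideanSpace.norm_le_sqrt_mul hδ.le fun k => ?_
      have h1 := Int.floor_le ((x - x₁) k / δ)
      have h2 := Int.lt_floor_add_one ((x - x₁) k / δ)
      rw [le_div_iff₀ hδ] at h1
      rw [div_lt_iff₀ hδ] at h2
      have h3 : (x - x₁) k = x k - x₁ k := rfl
      have h4 : (x - (x₁ + WithLp.toLp 2 fun k => δ * ((⌊(x - x₁) k / δ⌋ : ℤ) : ℝ))) k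
          = x k - (x₁ k + δ * ((⌊(x - x₁) k / δ⌋ : ℤ) : ℝ)) := rfl
      rw [h4, abs_le]
      constructor <;> nlinarith

section SubGamma

variable {S : Type*} [MeasurableSpace S] {D : Measure S} {σ a : ℝ} {X : S → ℝ}

theorem IsSubGamma.mgf_le [IsProbabilityMeasure D] (hX : IsSubGamma D σ a X) {l : ℝ}
    (hl : a * |l| ≤ 1 / 2) : mgf X D l ≤ exp (l ^ 2 * σ ^ 2) := by
  obtain ⟨h1, h2⟩ := hX l (by linarith)
  have h3 : 0 < mgf X D l := mgf_pos h1
  rw [← Real.log_le_iff_le_exp h3]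
  refine h2.trans ?_
  exact div_le_self (by positivity) (by linarith)

variable {Ω : Type*} {mΩ : MeasurableSpace Ω} {μ : Measure Ω}

/-- By independence the moment generating function of the sum is a power of that of one summand.
Keeping `a|l| ≤ 1/2` makes the sub-gamma bound Gaussian. -/
theorem IsSubGamma.exp_sum [IsProbabilityMeasure D] (hX : IsSubGamma D σ a X)
    (hXm : AEMeasurable X D) {ι : Type*} [Fintype ι] {ζ : ι → Ω → S}
    (hζ : ∀ i, Measurable (ζ i)) (hD : ∀ i, μ.map (ζ i) = D) (hind : iIndepFun ζ μ)
    {l : ℝ} (hl : a * |l| ≤ 1 / 2) :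
    Integrable (fun ω => exp (l * ∑ i, X (ζ i ω))) μ ∧
      ∫ ω, exp (l * ∑ i, X (ζ i ω)) ∂μ ≤ exp (Fintype.card ι * (l ^ 2 * σ ^ 2)) := by
  have hXm' : ∀ i, AEMeasurable X (μ.map (ζ i)) := fun i => by rw [hD i]; exact hXm
  have hcomp : iIndepFun (fun i => X ∘ ζ i) μ :=
    hind.comp₀ (fun _ => X) (fun i => (hζ i).aemeasurable) hXm'
  have hmeas : ∀ i, AEMeasurable (X ∘ ζ i) μ := fun i => (hXm' i).comp_measurable (hζ i)
  have hmgf : ∀ i, mgf (X ∘ ζ i) μ l = mgf X D l := fun i => by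
    rw [← hD i, mgf_map (hζ i).aemeasurable]
    exact ((hXm' i).const_mul l).exp.aestronglyMeasurable
  have hpos : 0 < mgf X D l := mgf_pos (hX l (by linarith)).1
  have hsum : mgf (∑ i, X ∘ ζ i) μ l = mgf X D l ^ Fintype.card ι := by
    rw [hcomp.mgf_sum₀ hmeas]
    simp [hmgf]
  have heq : (fun ω => exp (l * ∑ i, X (ζ i ω))) = fun ω => exp (l * (∑ i, X ∘ ζ i) ω) := by
    funext ω; simp
  have hprob : IsProbabilityMeasure μ := hind.isProbabilityMeasure
  rw [heq]
  refine ⟨?_, ?_⟩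
  -- The integral of a non-integrable function is `0` by convention, whereas the product of the
  -- moment generating functions is positive.
  · by_contra hne
    have h0 : mgf (∑ i, X ∘ ζ i) μ l = 0 := integral_undef hne
    rw [hsum] at h0
    exact (pow_pos hpos _).ne' h0
  · change mgf (∑ i, X ∘ ζ i) μ l ≤ _
    rw [hsum, Real.exp_nat_mul]
    exact pow_le_pow_left₀ hpos.le (hX.mgf_le hl) _

/-- A finite family with exponential moments has an integrable envelope whose mean grows only
logarithmically in the size of the family. -/
theorem exists_abs_envelope [IsProbabilityMeasure μ] {J : Type*} [Fintype J] {Y : J → Ω → ℝ}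
    {B : ℝ}
    (hp : ∀ j, Integrable (fun ω => exp (Y j ω)) μ ∧ ∫ ω, exp (Y j ω) ∂μ ≤ exp B)
    (hn : ∀ j, Integrable (fun ω => exp (-Y j ω)) μ ∧ ∫ ω, exp (-Y j ω) ∂μ ≤ exp B) :
    ∃ M : Ω → ℝ, Integrable M μ ∧ (∀ j ω, |Y j ω| ≤ M ω) ∧
      ∫ ω, M ω ∂μ ≤ log (2 * Fintype.card J + 1) + B := by
  -- The summand `1` keeps `A` positive for an empty family, which occurs when `d = 0`.
  set A : ℝ := (2 * Fintype.card J + 1) * exp B with hA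
  have hApos : 0 < A := by positivity
  set s : Ω → ℝ := fun ω => ∑ j, (exp (Y j ω) + exp (-Y j ω)) with hs
  have hsint : Integrable s μ := integrable_finsetSum _ fun j _ => (hp j).1.add (hn j).1
  have hsle : ∫ ω, s ω ∂μ ≤ A := by
    have h := integral_finsetSum (μ := μ) (f := fun j ω => exp (Y j ω) + exp (-Y j ω)) Finset.univ
      fun j _ => (hp j).1.add (hn j).1
    rw [hs, h]
    calc ∑ j, ∫ ω, (exp (Y j ω) + exp (-Y j ω)) ∂μ ≤ ∑ _j : J, (2 * exp B) :=
          Finset.sum_le_sum fun j _ => by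
            rw [integral_add (hp j).1 (hn j).1]
            linarith [(hp j).2, (hn j).2]
      _ = Fintype.card J * (2 * exp B) := by simp
      _ ≤ A := by rw [hA]; nlinarith [exp_pos B]
  -- The tangent of `log` at `A`, evaluated at `s`. It dominates `log s`, hence every `|Y j|`, and
  -- being affine in `s` it has mean at most `log A` without Jensen's inequality.
  refine ⟨fun ω => s ω / A + (log A - 1), (hsint.div_const A).add (integrable_const _), ?_, ?_⟩
  · intro j ω
    have h1 : exp |Y j ω| ≤ s ω := by
      refine le_trans ?_ (Finset.single_le_sum
        (f := fun j => exp (Y j ω) + exp (-Y j ω)) (fun j _ => by positivity) (Finset.mem_univ j))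
      rcases abs_choice (Y j ω) with h | h <;> rw [h] <;>
        linarith [exp_pos (Y j ω), exp_pos (-Y j ω)]
    have h2 : 0 < s ω / A := div_pos ((exp_pos _).trans_le h1) hApos
    have h3 := Real.add_one_le_exp (|Y j ω| - log A)
    rw [Real.exp_sub, Real.exp_log hApos] at h3
    have h4 : exp |Y j ω| / A ≤ s ω / A := by gcongr
    linarith
  · rw [integral_add (hsint.div_const A) (integrable_const _), integral_div]
    have h1 : (∫ ω, s ω ∂μ) / A ≤ 1 := (div_le_one hApos).2 hsle
    have h2 : log A = log (2 * Fintype.card J + 1) + B := by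
      rw [hA, Real.log_mul (by positivity) (exp_pos B).ne', Real.log_exp]
    simp only [integral_const, probReal_univ, smul_eq_mul, one_mul]
    linarith

end SubGamma

/-- The constant in the uniform bound of the sampling noise over a ball. -/
noncomputable def noiseConst (d : ℕ) (L σ a ρ : ℝ) : ℝ :=
  √(d : ℝ) * (1 + 2 * a) *
    (log 3 + log (d + 1) + 1 + d * (log (2 * ρ + 3) + 1) + ((1 + 2 * a)⁻¹ * σ) ^ 2)
    + 2 * L * √(d : ℝ)

theorem noiseConst_nonneg {d : ℕ} {L σ a ρ : ℝ} (hL : 0 ≤ L) (ha : 0 ≤ a) (hρ : 0 ≤ ρ) :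
    0 ≤ noiseConst d L σ a ρ := by
  have h1 : 0 ≤ log (3 : ℝ) := log_nonneg (by norm_num)
  have h2 : 0 ≤ log ((d : ℝ) + 1) := log_nonneg (by linarith [Nat.cast_nonneg (α := ℝ) d])
  have h3 : 0 ≤ log (2 * ρ + 3) := log_nonneg (by linarith)
  unfold noiseConst
  positivity

/-- The number of group, grid point and coordinate triples is polynomial in `Q`, so its logarithm is
`O(1 + log Q)`. Each side of the grid has at most `(2ρ + 3)Q` points. -/
theorem log_grid_card_le {d q n Q c : ℕ} {ρ r : ℝ} (hρ : 0 ≤ ρ) (hq : 1 ≤ q) (hqQ : q ≤ Q)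
    (hn : n = ⌈r⌉₊) (hr0 : 0 ≤ r) (hr : r ≤ ρ * Q) (hc : c ≤ (2 * n + 1) ^ d) :
    log (2 * ((q * (c * d) : ℕ) : ℝ) + 1) ≤
      (log 3 + log (d + 1) + 1 + d * (log (2 * ρ + 3) + 1)) * (1 + log Q) := by
  have hQ1 : (1 : ℝ) ≤ Q := by exact_mod_cast hq.trans hqQ
  have hq1 : (1 : ℝ) ≤ q := by exact_mod_cast hq
  have hqQ' : (q : ℝ) ≤ Q := by exact_mod_cast hqQ
  have hd0 : (0 : ℝ) ≤ d := Nat.cast_nonneg d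
  set P : ℝ := (2 * ρ + 3) * Q with hP
  have hP1 : 1 ≤ P := by nlinarith
  have hnP : ((2 * n + 1 : ℕ) : ℝ) ≤ P := by
    have : (n : ℝ) < r + 1 := by rw [hn]; exact Nat.ceil_lt_add_one hr0
    push_cast
    rw [hP]; nlinarith
  have hcP : (c : ℝ) ≤ P ^ d := by
    refine (Nat.cast_le.2 hc).trans ?_
    rw [Nat.cast_pow]
    exact pow_le_pow_left₀ (Nat.cast_nonneg _) hnP d
  have hPd : 1 ≤ P ^ d := one_le_pow₀ hP1
  have h1 : 2 * ((q * (c * d) : ℕ) : ℝ) + 1 ≤ 3 * (d + 1) * Q * P ^ d := by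
    push_cast
    have e1 : (q : ℝ) * (c * d) ≤ Q * (P ^ d * d) := by gcongr
    have e2 : (1 : ℝ) ≤ Q * P ^ d := one_le_mul_of_one_le_of_one_le hQ1 hPd
    have e3 : 0 ≤ d * (Q * P ^ d) := by positivity
    nlinarith
  refine (log_le_log (by positivity) h1).trans ?_
  have hlQ : 0 ≤ log Q := log_nonneg hQ1
  have h3 : 0 ≤ log (3 : ℝ) := log_nonneg (by norm_num)
  have h4 : 0 ≤ log ((d : ℝ) + 1) := log_nonneg (by linarith)
  have h5 : 0 ≤ log (2 * ρ + 3) := log_nonneg (by linarith)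
  have h6 : 0 ≤ d * log (2 * ρ + 3) := mul_nonneg hd0 h5
  have hne : (2 * ρ + 3) ≠ 0 := by positivity
  rw [log_mul (by positivity) (by positivity), log_mul (by positivity) (by positivity),
    log_mul (by norm_num) (by positivity), log_pow, hP, log_mul hne (by positivity)]
  nlinarith [mul_nonneg h3 hlQ, mul_nonneg h4 hlQ, mul_nonneg h6 hlQ, mul_nonneg hd0 hlQ]

variable {S : Type*} [MeasurableSpace S] {D : Measure S} [IsProbabilityMeasure D] {σ a L : ℝ}
  {d : ℕ} {f : EuclideanSpace ℝ (Fin d) → S → ℝ}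
  {Ω : Type*} {mΩ : MeasurableSpace Ω} {μ : Measure Ω} [IsProbabilityMeasure μ]

/-- The deviation at `x` of the average gradient over the samples `z` from its mean. -/
noncomputable def gradNoise {d : ℕ} {S : Type*} [MeasurableSpace S] (D : Measure S)
    (f : EuclideanSpace ℝ (Fin d) → S → ℝ) {ι : Type*} [Fintype ι] (z : ι → S)
    (x : EuclideanSpace ℝ (Fin d)) : EuclideanSpace ℝ (Fin d) :=
  (1 / (Fintype.card ι : ℝ)) • ∑ i, (gradient (fun y => f y (z i)) x - gradient (risk D f) x)

theorem gradNoise_lipschitz (hL0 : 0 ≤ L) (hf : ∀ x, Integrable (f x) D)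
    (hL : ∀ z, IsLSmooth L fun x => f x z) {ι : Type*} [Fintype ι] (z : ι → S)
    (x y : EuclideanSpace ℝ (Fin d)) :
    ‖gradNoise D f z x - gradNoise D f z y‖ ≤ 2 * L * ‖x - y‖ := by
  rw [gradNoise, gradNoise, ← smul_sub, ← Finset.sum_sub_distrib, norm_smul]
  have h1 : ‖∑ i, (gradient (fun y => f y (z i)) x - gradient (risk D f) x
      - (gradient (fun y => f y (z i)) y - gradient (risk D f) y))‖
      ≤ ∑ _i : ι, 2 * L * ‖x - y‖ := norm_sum_le_of_le _ fun i _ => by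
    have e : gradient (fun y => f y (z i)) x - gradient (risk D f) x
      - (gradient (fun y => f y (z i)) y - gradient (risk D f) y)
      = (gradient (fun y => f y (z i)) x - gradient (fun y => f y (z i)) y)
        - (gradient (risk D f) x - gradient (risk D f) y) := by abel
    rw [e]
    refine (norm_sub_le _ _).trans ?_
    have h2 := (hL (z i)).2 x y
    have h3 := (isLSmooth_risk hf hL).2 x y
    linarith
  rw [Finset.sum_const, Finset.card_univ, nsmul_eq_mul] at h1
  have h0 : 0 ≤ 2 * L * ‖x - y‖ := by positivity
  rw [Real.norm_of_nonneg (by positivity)]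
  rcases Nat.eq_zero_or_pos (Fintype.card ι) with h | h
  · rw [h]; simpa using h0
  · have hc : (0 : ℝ) < Fintype.card ι := by exact_mod_cast h
    rw [one_div, inv_mul_le_iff₀ hc]
    exact h1

/-- Uniformly over a ball and over finitely many groups of `n` i.i.d. samples, the sampling noise
has an integrable envelope of mean `O(log Q / √n)`. -/
theorem exists_noise_envelope (hL0 : 0 ≤ L) (ha : 0 ≤ a) (hf : ∀ x, Integrable (f x) D)
    (hL : ∀ z, IsLSmooth L fun x => f x z) (hsg : HasSubGammaNoise D σ a f)
    {κ ι : Type*} [Fintype κ] [Nonempty κ] [Fintype ι] [Nonempty ι] {ζ : κ → ι → Ω → S}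
    (hζ : ∀ q i, Measurable (ζ q i)) (hD : ∀ q i, μ.map (ζ q i) = D)
    (hind : ∀ q, iIndepFun (ζ q) μ) (x₁ : EuclideanSpace ℝ (Fin d)) {R δ ρ : ℝ} {Q : ℕ}
    (hR : 0 ≤ R) (hδ : 0 < δ) (hρ : 0 ≤ ρ) (hQ : Fintype.card κ ≤ Q) (hRδ : R / δ ≤ ρ * Q)
    (hδn : δ ≤ 1 / √(Fintype.card ι : ℝ)) :
    ∃ M : Ω → ℝ, Integrable M μ ∧
      (∀ ω q x, ‖x - x₁‖ ≤ R → ‖gradNoise D f (fun i => ζ q i ω) x‖ ≤ M ω) ∧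
      ∫ ω, M ω ∂μ ≤ noiseConst d L σ a ρ * (1 + log Q) * (1 / √(Fintype.card ι : ℝ)) := by
  obtain ⟨t, htcard, htcov⟩ := exists_grid x₁ R hδ
  set n : ℝ := (Fintype.card ι : ℝ) with hn
  have hn1 : (1 : ℝ) ≤ n := by rw [hn]; exact_mod_cast Fintype.card_pos
  have hsn : 1 ≤ √n := Real.one_le_sqrt.2 hn1
  have hsn0 : 0 < √n := by linarith
  -- The exponent `u/√n` stays in the range `a|l| ≤ 1/2` for every `n ≥ 1`, and the `n` summands
  -- together contribute `(uσ)²`, independent of `n`.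
  set u : ℝ := (1 + 2 * a)⁻¹ with hu
  have hu0 : 0 < u := by positivity
  set X : t → Fin d → S → ℝ :=
    fun y k z => gradient (fun v => f v z) y k - gradient (risk D f) y k with hX
  have hXm : ∀ y k, AEMeasurable (X y k) D := fun y k =>
    (((integrable_gradient hf hL (y : EuclideanSpace ℝ (Fin d))).eval_piLp k).sub
      (integrable_const _)).aestronglyMeasurable.aemeasurable
  have hl : a * |u / √n| ≤ 1 / 2 := by
    rw [abs_of_pos (div_pos hu0 hsn0)]
    have h1 : u / √n ≤ u := div_le_self hu0.le hsn
    have h2 : a * u ≤ 1 / 2 := by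
      rw [hu, ← div_eq_mul_inv, div_le_iff₀ (by positivity)]; linarith
    nlinarith
  have hl' : a * |-(u / √n)| ≤ 1 / 2 := by rwa [abs_neg]
  have hvar : n * ((u / √n) ^ 2 * σ ^ 2) = (u * σ) ^ 2 := by
    rw [div_pow, Real.sq_sqrt (by linarith)]; field_simp
  obtain ⟨M, hMint, hM, hMle⟩ := exists_abs_envelope (μ := μ) (J := κ × (t × Fin d))
    (Y := fun j ω => u / √n * ∑ i, X j.2.1 j.2.2 (ζ j.1 i ω)) (B := (u * σ) ^ 2)
    (fun j => by
      have h := (hsg j.2.1 j.2.2).exp_sum (hXm j.2.1 j.2.2) (hζ j.1) (hD j.1) (hind j.1) hl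
      rw [hvar] at h; exact h)
    (fun j => by
      have h := (hsg j.2.1 j.2.2).exp_sum (hXm j.2.1 j.2.2) (hζ j.1) (hD j.1) (hind j.1) hl'
      rw [neg_sq, hvar] at h
      simpa only [neg_mul] using h)
  -- The first term bounds the noise at grid points; the second is the cost of moving to the nearest
  -- one, since the noise is `2L`-Lipschitz.
  refine ⟨fun ω => √(d : ℝ) * (M ω / (u * √n)) + 2 * L * (√(d : ℝ) * δ),
    ((hMint.div_const _).const_mul _).add (integrable_const _), ?_, ?_⟩
  · intro ω q x hx
    obtain ⟨y, hy, hxy⟩ := htcov x hx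
    have h1 := gradNoise_lipschitz hL0 hf hL (fun i => ζ q i ω) x y
    have h2 : ‖gradNoise D f (fun i => ζ q i ω) y‖ ≤ √(d : ℝ) * (M ω / (u * √n)) := by
      rcases Nat.eq_zero_or_pos d with rfl | hd
      · rw [Subsingleton.elim (gradNoise D f (fun i => ζ q i ω) y) 0]; simp
      · have hcoord : ∀ k, |gradNoise D f (fun i => ζ q i ω) y k| ≤ M ω / (u * √n) := by
          intro k
          have h3 := hM (q, ⟨y, hy⟩, k) ω
          simp only at h3
          have h4 : gradNoise D f (fun i => ζ q i ω) y k
              = (1 / n) * ∑ i, X ⟨y, hy⟩ k (ζ q i ω) := by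
            simp [gradNoise, hX, hn]
          rw [h4, le_div_iff₀ (by positivity), ← abs_of_pos (mul_pos hu0 hsn0), ← abs_mul]
          have h5 : √n * √n = n := Real.mul_self_sqrt (by linarith)
          have h6 : (1 / n * ∑ i, X ⟨y, hy⟩ k (ζ q i ω)) * (u * √n)
              = u / √n * ∑ i, X ⟨y, hy⟩ k (ζ q i ω) := by
            have h7 : 1 / n * (u * √n) = u / √n := by
              rw [one_div_mul_eq_div, div_eq_div_iff (by positivity) hsn0.ne', mul_assoc, h5]
            rw [← h7]; ring
          rw [h6]
          exact h3
        exact EuclideanSpace.norm_le_sqrt_mul ((abs_nonneg _).trans (hcoord ⟨0, hd⟩)) hcoord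
    calc ‖gradNoise D f (fun i => ζ q i ω) x‖
        ≤ ‖gradNoise D f (fun i => ζ q i ω) y‖
          + ‖gradNoise D f (fun i => ζ q i ω) x - gradNoise D f (fun i => ζ q i ω) y‖ := by
          rw [add_comm]; exact norm_le_norm_sub_add _ _
      _ ≤ _ := by
          refine add_le_add h2 (h1.trans ?_)
          gcongr
  · rw [integral_add ((hMint.div_const _).const_mul _) (integrable_const _), integral_const_mul,
      integral_div]
    simp only [integral_const, probReal_univ, smul_eq_mul, one_mul]
    have hcard : Fintype.card (κ × (t × Fin d)) = Fintype.card κ * (t.card * d) := by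
      simp
    have hQ1 : (1 : ℝ) ≤ Q := by exact_mod_cast (Fintype.card_pos (α := κ)).trans_le hQ
    have hlQ : 0 ≤ log Q := log_nonneg hQ1
    have hlog := log_grid_card_le (d := d) (c := t.card) hρ (Fintype.card_pos (α := κ)) hQ rfl
      (by positivity) hRδ htcard
    rw [hcard] at hMle
    set A := log 3 + log ((d : ℝ) + 1) + 1 + d * (log (2 * ρ + 3) + 1) with hA
    have hM2 : ∫ ω, M ω ∂μ ≤ (A + (u * σ) ^ 2) * (1 + log Q) := by
      nlinarith [mul_nonneg (sq_nonneg (u * σ)) hlQ]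
    have e1 : √(d : ℝ) * ((∫ ω, M ω ∂μ) / (u * √n))
        ≤ √(d : ℝ) * ((A + (u * σ) ^ 2) * (1 + log Q) / (u * √n)) := by gcongr
    have e2 : 2 * L * (√(d : ℝ) * δ) ≤ 2 * L * √(d : ℝ) * (1 + log Q) * (1 / √n) := by
      have h5 : 2 * L * (√(d : ℝ) * δ) ≤ 2 * L * (√(d : ℝ) * (1 / √n)) := by gcongr
      have h6 : 0 ≤ 2 * L * (√(d : ℝ) * (1 / √n)) * log Q := by positivity
      nlinarith
    have e3 : noiseConst d L σ a ρ * (1 + log Q) * (1 / √n)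
        = √(d : ℝ) * ((A + (u * σ) ^ 2) * (1 + log Q) / (u * √n))
          + 2 * L * √(d : ℝ) * (1 + log Q) * (1 / √n) := by
      have hui : 1 + 2 * a = u⁻¹ := by rw [hu, inv_inv]
      unfold noiseConst
      clear_value u
      rw [hui, inv_inv, ← hA]
      field_simp
    rw [e3]
    exact add_le_add e1 e2

end Noise

/-! ### The robust mean -/

section RobustMean

/-- The root in `Calpha` is at least `1`, because `(1 - α)² ≥ 1 - 2α`. Hence a coordinatewise error
factor `4α/(1 - α)` is enough below. -/
theorem four_mul_div_le_Calpha (d : ℕ) {α : ℝ} (h0 : 0 ≤ α) (h1 : α < 1 / 2) :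
    √(d : ℝ) * (4 * α / (1 - α)) ≤ Calpha d α := by
  have h2 : 1 ≤ √((1 - α) ^ 2 / (1 - 2 * α)) := by
    rw [Real.one_le_sqrt, le_div_iff₀ (by linarith)]
    nlinarith
  have h3 : 0 ≤ 2 * α / (1 - α) := div_nonneg (by linarith) (by linarith)
  unfold Calpha
  rw [mul_comm]
  refine mul_le_mul_of_nonneg_right ?_ (Real.sqrt_nonneg _)
  have h4 : 4 * α / (1 - α) = 2 * α / (1 - α) * 2 := by ring
  rw [h4]
  exact mul_le_mul_of_nonneg_left (by linarith) h3

theorem Calpha_nonneg (d : ℕ) {α : ℝ} (h0 : 0 ≤ α) (h1 : α < 1 / 2) : 0 ≤ Calpha d α := by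
  unfold Calpha
  have h3 : 0 ≤ 2 * α / (1 - α) := div_nonneg (by linarith) (by linarith)
  positivity

/-- The good indices are more than half of all, so some good entry lies on each side of the median.
-/
theorem IsMedian.abs_sub_le {k : ℕ} {α : ℝ} (hα : α < 1 / 2) (hk : 1 ≤ k) {v : Fin k → ℝ} {c : ℝ}
    (hc : IsMedian v c) {G : Finset (Fin k)} (hG : (1 - α) * k ≤ G.card) {y ρ : ℝ}
    (hGy : ∀ i ∈ G, |v i - y| ≤ ρ) : |c - y| ≤ ρ := by
  have hk0 : (0 : ℝ) < k := by exact_mod_cast hk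
  have key : ∀ A : Finset (Fin k), k ≤ 2 * A.card → ∃ i ∈ G, i ∈ A := by
    intro A hA
    by_contra! hne
    have hdis : Disjoint G A := Finset.disjoint_left.2 hne
    have h1 := Finset.card_le_univ (G ∪ A)
    rw [Finset.card_union_of_disjoint hdis, Fintype.card_fin] at h1
    have h2 : (G.card : ℝ) + A.card ≤ k := by exact_mod_cast h1
    have h3 : (k : ℝ) ≤ 2 * A.card := by exact_mod_cast hA
    nlinarith
  obtain ⟨i, hi, hi'⟩ := key _ hc.1
  obtain ⟨j, hj, hj'⟩ := key _ hc.2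
  have h1 := abs_le.1 (hGy i hi)
  have h2 := abs_le.1 (hGy j hj)
  have h3 := (Finset.mem_filter.1 hi').2
  have h4 := (Finset.mem_filter.1 hj').2
  rw [abs_le]
  constructor <;> linarith [h1.1, h2.2]

/-- The selected set and the good set have equal size, so they differ by a swap of at most `αk`
entries. All swapped entries lie within `2ρ` of the median, which gives `2 · αk · 2ρ`. -/
theorem abs_sum_nearest_sub_sum_le {k : ℕ} {α : ℝ} (hα : α < 1 / 2)
    (hk : 1 ≤ k) {v : Fin k → ℝ} {c : ℝ} (hc : IsMedian v c) {I G : Finset (Fin k)}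
    (hI : (I.card : ℝ) = (1 - α) * k) (hIn : ∀ i ∈ I, ∀ i' ∉ I, |v i - c| ≤ |v i' - c|)
    (hG : (G.card : ℝ) = (1 - α) * k) {y ρ : ℝ} (hGy : ∀ i ∈ G, |v i - y| ≤ ρ) :
    |∑ i ∈ I, v i - ∑ i ∈ G, v i| ≤ 4 * (α * k) * ρ := by
  have hcy := hc.abs_sub_le hα hk hG.ge hGy
  have hρ : 0 ≤ ρ := (abs_nonneg _).trans hcy
  have hGc : ∀ i ∈ G, |v i - c| ≤ 2 * ρ := fun i hi => by
    have h1 := abs_sub_le (v i) y c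
    rw [abs_sub_comm y c] at h1
    linarith [hGy i hi]
  have hcardN : I.card = G.card := by exact_mod_cast hI.trans hG.symm
  have hcard : (I \ G).card = (G \ I).card := by
    have h1 := Finset.card_sdiff_add_card_inter I G
    have h2 := Finset.card_sdiff_add_card_inter G I
    rw [Finset.inter_comm] at h2
    omega
  -- A selected bad entry forces some good entry to be left out, and that one is no nearer to the
  -- median.
  have hIc : ∀ i ∈ I \ G, |v i - c| ≤ 2 * ρ := fun i hi => by
    have hpos : 0 < (G \ I).card := hcard ▸ Finset.card_pos.2 ⟨i, hi⟩
    obtain ⟨j, hj⟩ := Finset.card_pos.1 hpos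
    obtain ⟨hjG, hjI⟩ := Finset.mem_sdiff.1 hj
    exact (hIn i (Finset.mem_sdiff.1 hi).1 j hjI).trans (hGc j hjG)
  have hsmall : ((I \ G).card : ℝ) ≤ α * k := by
    have h1 : (I \ G).card + G.card ≤ k := by
      have h2 := Finset.card_le_univ (I ∪ G)
      rw [Fintype.card_fin] at h2
      rwa [Finset.card_sdiff_add_card]
    have h2 : ((I \ G).card : ℝ) + G.card ≤ k := by exact_mod_cast h1
    rw [hG] at h2
    linarith
  have hsplit : ∑ i ∈ I, v i - ∑ i ∈ G, v i
      = ∑ i ∈ I \ G, (v i - c) - ∑ i ∈ G \ I, (v i - c) := by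
    have h1 := Finset.sum_sdiff_sub_sum_sdiff (s₁ := G) (s₂ := I) (f := v)
    rw [Finset.sum_sub_distrib, Finset.sum_sub_distrib, Finset.sum_const, Finset.sum_const, hcard,
      sub_sub_sub_cancel_right]
    exact h1.symm
  have b1 : |∑ i ∈ I \ G, (v i - c)| ≤ (I \ G).card * (2 * ρ) := by
    refine (Finset.abs_sum_le_sum_abs _ _).trans ?_
    rw [← nsmul_eq_mul]
    exact Finset.sum_le_card_nsmul _ _ _ hIc
  have b2 : |∑ i ∈ G \ I, (v i - c)| ≤ (I \ G).card * (2 * ρ) := by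
    refine (Finset.abs_sum_le_sum_abs _ _).trans ?_
    rw [hcard, ← nsmul_eq_mul]
    exact Finset.sum_le_card_nsmul _ _ _ fun i hi => hGc i (Finset.mem_sdiff.1 hi).1
  rw [hsplit]
  refine (abs_sub _ _).trans ?_
  nlinarith

variable {d k : ℕ} {α : ℝ} {v : Fin k → EuclideanSpace ℝ (Fin d)}
  {vhat y : EuclideanSpace ℝ (Fin d)} {ρ : ℝ}

theorem IsRobustMean.norm_sub_mean_le (h0 : 0 ≤ α) (hα : α < 1 / 2) (hk : 1 ≤ k)
    (hv : IsRobustMean α v vhat) {G : Finset (Fin k)} (hG : (G.card : ℝ) = (1 - α) * k)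
    (hGy : ∀ i ∈ G, ‖v i - y‖ ≤ ρ) :
    ‖vhat - (1 / ((1 - α) * k)) • ∑ i ∈ G, v i‖ ≤ Calpha d α * ρ := by
  have hk0 : (0 : ℝ) < k := by exact_mod_cast hk
  have h1α : 0 < 1 - α := by linarith
  have hGpos : 0 < G.card := by
    have : (0 : ℝ) < G.card := by rw [hG]; positivity
    exact_mod_cast this
  obtain ⟨i₀, hi₀⟩ := Finset.card_pos.1 hGpos
  have hρ : 0 ≤ ρ := (norm_nonneg _).trans (hGy i₀ hi₀)
  rcases Nat.eq_zero_or_pos d with rfl | hd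
  · rw [Subsingleton.elim (vhat - (1 / ((1 - α) * k)) • ∑ i ∈ G, v i) 0, norm_zero]
    exact mul_nonneg (Calpha_nonneg _ h0 hα) hρ
  have hcoord : ∀ j, |(vhat - (1 / ((1 - α) * k)) • ∑ i ∈ G, v i) j| ≤ 4 * α / (1 - α) * ρ := by
    intro j
    obtain ⟨c, hc, I, hI, hIn, hj⟩ := hv j
    have h1 := abs_sum_nearest_sub_sum_le hα hk hc hI hIn hG (y := y j) (ρ := ρ)
      fun i hi => (EuclideanSpace.abs_apply_le_norm (v i - y) j).trans (hGy i hi)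
    have h2 : (vhat - (1 / ((1 - α) * k)) • ∑ i ∈ G, v i) j
        = (1 / ((1 - α) * k)) * (∑ i ∈ I, v i j - ∑ i ∈ G, v i j) := by
      simp [hj, mul_sub]
    rw [h2, abs_mul, abs_of_pos (by positivity), one_div, inv_mul_le_iff₀ (by positivity)]
    refine h1.trans (le_of_eq ?_)
    field_simp
  refine (EuclideanSpace.norm_le_sqrt_mul (by positivity) hcoord).trans ?_
  rw [← mul_assoc]
  exact mul_le_mul_of_nonneg_right (four_mul_div_le_Calpha d h0 hα) hρ

theorem norm_mean_le {G : Finset (Fin k)} (hα : α < 1) (hk : 1 ≤ k)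
    (hG : (G.card : ℝ) = (1 - α) * k) (hv : ∀ i ∈ G, ‖v i‖ ≤ ρ) :
    ‖(1 / ((1 - α) * k)) • ∑ i ∈ G, v i‖ ≤ ρ := by
  have hk0 : (0 : ℝ) < k := by exact_mod_cast hk
  have h1α : 0 < 1 - α := by linarith
  rw [norm_smul, Real.norm_of_nonneg (by positivity), one_div, inv_mul_le_iff₀ (by positivity),
    ← hG, ← nsmul_eq_mul, ← Finset.sum_const]
  exact norm_sum_le_of_le _ hv

theorem mean_sub {G : Finset (Fin k)} (hα : α < 1) (hk : 1 ≤ k)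
    (hG : (G.card : ℝ) = (1 - α) * k) (y : EuclideanSpace ℝ (Fin d)) :
    (1 / ((1 - α) * k)) • ∑ i ∈ G, v i - y = (1 / ((1 - α) * k)) • ∑ i ∈ G, (v i - y) := by
  have hk0 : (0 : ℝ) < k := by exact_mod_cast hk
  have h1α : 0 < 1 - α := by linarith
  rw [Finset.sum_sub_distrib, smul_sub, Finset.sum_const, ← Nat.cast_smul_eq_nsmul ℝ, hG,
    smul_smul, one_div_mul_cancel (by positivity), one_smul]

theorem exists_subset_card_eq_one_sub_mul {G : Finset (Fin k)} (hn : ∃ n : ℕ, α * k = n)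
    (hα : α < 1 / 2) (hG : (1 - α) * k ≤ G.card) :
    ∃ G' ⊆ G, (G'.card : ℝ) = (1 - α) * k := by
  obtain ⟨n, hn⟩ := hn
  have h1 : (k : ℝ) ≤ G.card + n := by linarith
  have h2 : k ≤ G.card + n := by exact_mod_cast h1
  have h3 := Finset.card_le_univ G
  rw [Fintype.card_fin] at h3
  have h3' : (G.card : ℝ) ≤ k := by exact_mod_cast h3
  rcases le_or_gt n k with h4 | h4
  · obtain ⟨G', hG', hc⟩ := Finset.exists_subset_card_eq (show k - n ≤ G.card by omega)
    refine ⟨G', hG', ?_⟩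
    rw [hc, Nat.cast_sub h4]
    linarith
  · exfalso
    have h5 : (k : ℝ) < n := by exact_mod_cast h4
    rw [← hn] at h5
    nlinarith [Nat.cast_nonneg (α := ℝ) k]

/-- Discarding a fraction `α` of the vectors changes their mean by little. -/
theorem norm_mean_subset_le (h0 : 0 ≤ α) (hα : α < 1 / 2) (hk : 1 ≤ k) {G : Finset (Fin k)}
    (hG : (G.card : ℝ) = (1 - α) * k) (hv : ∀ i, ‖v i‖ ≤ ρ) :
    ‖(1 / ((1 - α) * k)) • ∑ i ∈ G, v i‖ ≤ 2 * ‖(1 / (k : ℝ)) • ∑ i, v i‖ + Calpha d α * ρ := by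
  have hk0 : (0 : ℝ) < k := by exact_mod_cast hk
  have h1α : 0 < 1 - α := by linarith
  have hρ : 0 ≤ ρ := (norm_nonneg _).trans (hv ⟨0, hk⟩)
  rcases Nat.eq_zero_or_pos d with rfl | hd
  · rw [Subsingleton.elim ((1 / ((1 - α) * k)) • ∑ i ∈ G, v i) 0, norm_zero]
    have := mul_nonneg (Calpha_nonneg 0 h0 hα) hρ
    positivity
  have hc : ((Gᶜ : Finset (Fin k)).card : ℝ) = α * k := by
    have h1 := Finset.card_add_card_compl G
    rw [Fintype.card_fin] at h1
    have h2 : (G.card : ℝ) + (Gᶜ : Finset (Fin k)).card = k := by exact_mod_cast h1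
    linarith
  have h1 : ‖∑ i ∈ Gᶜ, v i‖ ≤ α * k * ρ := by
    rw [← hc, ← nsmul_eq_mul, ← Finset.sum_const]
    exact norm_sum_le_of_le _ fun i _ => hv i
  have h2 : ‖∑ i ∈ G, v i‖ ≤ ‖∑ i, v i‖ + α * k * ρ := by
    have h3 : ∑ i ∈ G, v i = ∑ i, v i - ∑ i ∈ Gᶜ, v i := by
      rw [← Finset.sum_add_sum_compl G v]; abel
    rw [h3]
    exact (norm_sub_le _ _).trans (by linarith)
  -- This needs `√d ≥ 1`, hence the separate case `d = 0`. The factor `2` in the statement absorbs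
  -- `1/(1 - α)`.
  have h4 : α ≤ Calpha d α * (1 - α) := by
    have h5 := four_mul_div_le_Calpha d h0 hα
    have h6 : (1 : ℝ) ≤ √(d : ℝ) := Real.one_le_sqrt.2 (by exact_mod_cast hd)
    have h7 : 4 * α / (1 - α) ≤ √(d : ℝ) * (4 * α / (1 - α)) :=
      le_mul_of_one_le_left (by positivity) h6
    have h8 := (div_le_iff₀ h1α).1 (h7.trans h5)
    linarith
  rw [norm_smul, norm_smul, Real.norm_of_nonneg (by positivity), Real.norm_of_nonneg (by positivity),
    one_div, inv_mul_le_iff₀ (by positivity)]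
  have h9 : (1 - α) * k * (2 * (1 / (k : ℝ) * ‖∑ i, v i‖) + Calpha d α * ρ)
      = 2 * (1 - α) * ‖∑ i, v i‖ + Calpha d α * (1 - α) * (k * ρ) := by
    field_simp
  rw [h9]
  have h10 : α * (k * ρ) ≤ Calpha d α * (1 - α) * (k * ρ) :=
    mul_le_mul_of_nonneg_right h4 (by positivity)
  nlinarith [norm_nonneg (∑ i, v i)]

end RobustMean

/-! ### Runs of the algorithm -/

section Run

variable {d : ℕ}

theorem norm_normalize_le_one (a : EuclideanSpace ℝ (Fin d)) : ‖‖a‖⁻¹ • a‖ ≤ 1 := by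
  rw [norm_smul, norm_inv, norm_norm]
  exact inv_mul_le_one

/-- The inner product of `a` with its own direction is `‖a‖`. Replacing `a` by `G` in the inner
product and in the norm costs `‖a - G‖` each; `a = 0` is covered. -/
theorem norm_sub_two_mul_le_inner_normalize (G a : EuclideanSpace ℝ (Fin d)) :
    ‖G‖ - 2 * ‖a - G‖ ≤ inner ℝ G (‖a‖⁻¹ • a) := by
  have h1 : inner ℝ a (‖a‖⁻¹ • a) = ‖a‖ := by
    rw [inner_smul_right, real_inner_self_eq_norm_sq]
    rcases eq_or_ne ‖a‖ 0 with h | h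
    · simp [h]
    · field_simp
  have h2 : inner ℝ (a - G) (‖a‖⁻¹ • a) ≤ ‖a - G‖ :=
    (real_inner_le_norm _ _).trans
      (mul_le_of_le_one_right (norm_nonneg _) (norm_normalize_le_one a))
  rw [inner_sub_left, h1] at h2
  have h3 : ‖G‖ ≤ ‖a‖ + ‖a - G‖ := by
    have := norm_sub_norm_le G a
    rw [norm_sub_rev] at this
    linarith
  linarith

variable {N m H : ℕ} {α₁ α₂ γ L : ℝ} {x₁ : EuclideanSpace ℝ (Fin d)}
  {honest : Fin N → EuclideanSpace ℝ (Fin d) → EuclideanSpace ℝ (Fin d)}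
  {w : ℕ → Fin N → Bool} {g ghat : ℕ → Fin N → EuclideanSpace ℝ (Fin d)}
  {agg x : ℕ → EuclideanSpace ℝ (Fin d)} {F : EuclideanSpace ℝ (Fin d) → ℝ}

namespace IsRangeRun

theorem norm_step_le (hr : IsRangeRun m H α₁ α₂ γ x₁ honest w g ghat agg x) (hγ : 0 ≤ γ) {t : ℕ}
    (h1 : 1 ≤ t) (hH : t ≤ H) : ‖x (t + 1) - x t‖ ≤ γ := by
  rw [hr.step t h1 hH, sub_sub_cancel_left, norm_neg, norm_smul, Real.norm_of_nonneg hγ]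
  exact mul_le_of_le_one_right hγ (norm_normalize_le_one _)

theorem norm_drift_le (hr : IsRangeRun m H α₁ α₂ γ x₁ honest w g ghat agg x) (hγ : 0 ≤ γ) {s : ℕ}
    (h1 : 1 ≤ s) (k : ℕ) (hH : s + k ≤ H + 1) : ‖x (s + k) - x s‖ ≤ k * γ := by
  induction k with
  | zero => simp
  | succ k ih =>
    have h2 := hr.norm_step_le hγ (show 1 ≤ s + k by omega) (by omega)
    have h3 := ih (by omega)
    have h4 : x (s + (k + 1)) - x s = (x (s + k + 1) - x (s + k)) + (x (s + k) - x s) := by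
      rw [← add_assoc]; abel
    rw [h4]
    refine (norm_add_le _ _).trans ?_
    push_cast
    linarith

theorem descent (hr : IsRangeRun m H α₁ α₂ γ x₁ honest w g ghat agg x) (hγ : 0 ≤ γ)
    (hL : 0 ≤ L) (hF : IsLSmooth L F) {t : ℕ} (h1 : 1 ≤ t) (hH : t ≤ H) :
    F (x (t + 1)) ≤ F (x t) - γ * inner ℝ (gradient F (x t)) (‖agg t‖⁻¹ • agg t)
      + L / 2 * γ ^ 2 := by
  have h2 := (abs_le.1 (hF.abs_taylor_le (x t) (x (t + 1)))).2
  have h3 := hr.norm_step_le hγ h1 hH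
  have h4 : L / 2 * ‖x (t + 1) - x t‖ ^ 2 ≤ L / 2 * γ ^ 2 := by gcongr
  have h5 : x (t + 1) - x t = -(γ • (‖agg t‖⁻¹ • agg t)) := by
    rw [hr.step t h1 hH, sub_sub_cancel_left]
  have h6 : inner ℝ (gradient F (x t)) (x (t + 1) - x t)
      = -(γ * inner ℝ (gradient F (x t)) (‖agg t‖⁻¹ • agg t)) := by
    rw [h5, inner_neg_right, inner_smul_right]
  rw [h6] at h2
  linarith

theorem descent_of_norm_sub_le (hr : IsRangeRun m H α₁ α₂ γ x₁ honest w g ghat agg x)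
    (hγ : 0 ≤ γ) (hL : 0 ≤ L) (hF : IsLSmooth L F) {t : ℕ} (h1 : 1 ≤ t) (hH : t ≤ H) {E : ℝ}
    (hE : ‖agg t - gradient F (x t)‖ ≤ E) :
    F (x (t + 1)) ≤ F (x t) - γ * ‖gradient F (x t)‖ + 2 * γ * E + L / 2 * γ ^ 2 := by
  have h2 := hr.descent hγ hL hF h1 hH
  have h3 := norm_sub_two_mul_le_inner_normalize (gradient F (x t)) (agg t)
  nlinarith

theorem ascent_le (hr : IsRangeRun m H α₁ α₂ γ x₁ honest w g ghat agg x)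
    (hγ : 0 ≤ γ) (hL : 0 ≤ L) (hF : IsLSmooth L F) {t : ℕ} (h1 : 1 ≤ t) (hH : t ≤ H) :
    F (x (t + 1)) ≤ F (x t) + γ * ‖gradient F (x t)‖ + L / 2 * γ ^ 2 := by
  have h2 := hr.descent hγ hL hF h1 hH
  have h3 := (abs_le.1 ((abs_real_inner_le_norm (gradient F (x t)) (‖agg t‖⁻¹ • agg t)).trans
    (mul_le_of_le_one_right (norm_nonneg _) (norm_normalize_le_one _)))).1
  nlinarith

open Classical in
/-- If temporal averaging works for an agent, its robustified gradient is nearly honest. -/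
theorem norm_ghat_sub_le (hr : IsRangeRun m H α₁ α₂ γ x₁ honest w g ghat agg x) (hγ : 0 ≤ γ)
    (hL : 0 ≤ L) (hα0 : 0 ≤ α₁) (hα : α₁ < 1 / 2) (hint : ∃ n : ℕ, α₁ * m = n) (hm : 1 ≤ m)
    (hhon : ∀ i x y, ‖honest i x - honest i y‖ ≤ L * ‖x - y‖) {t r : ℕ} (hr1 : 1 ≤ r)
    (hrt : r + m = t + 1) (hH : t ≤ H) {i : Fin N}
    (hok : ¬ TemporalFails α₁ fun τ : Fin m => w (r + τ) i) :
    ‖ghat t i - honest i (x t)‖ ≤ (Calpha d α₁ + 1) * (L * (((m : ℝ) - 1) * γ)) := by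
  -- The algorithm reads the window backwards from `t`, the failure event forwards from `r = t - m +
  -- 1`.
  have hrev : (Finset.univ.filter fun τ : Fin m => w (t - τ) i = true).card
      = (Finset.univ.filter fun τ : Fin m => w (r + τ) i = true).card := by
    refine Finset.card_bij (fun τ _ => Fin.rev τ) (fun τ hτ => ?_) (fun _ _ _ _ h => Fin.rev_injective h)
      fun τ hτ => ⟨Fin.rev τ, ?_, Fin.rev_rev τ⟩
    · have e : r + (Fin.rev τ : ℕ) = t - τ := by rw [Fin.val_rev]; omega
      rw [Finset.mem_filter] at hτ ⊢
      exact ⟨Finset.mem_univ _, by rw [e]; exact hτ.2⟩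
    · have e : t - (Fin.rev τ : ℕ) = r + τ := by rw [Fin.val_rev]; omega
      rw [Finset.mem_filter] at hτ ⊢
      exact ⟨Finset.mem_univ _, by rw [e]; exact hτ.2⟩
  have hgood : (1 - α₁) * m ≤
      ((Finset.univ.filter fun τ : Fin m => w (t - τ) i = false).card : ℝ) := by
    have h1 := Finset.card_filter_add_card_filter_not (s := (Finset.univ : Finset (Fin m)))
      (fun τ : Fin m => w (t - τ) i = true)
    simp only [Bool.not_eq_true, Finset.card_univ, Fintype.card_fin] at h1
    unfold TemporalFails at hok
    rw [not_lt, ← hrev] at hok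
    have h2 : ((Finset.univ.filter fun τ : Fin m => w (t - τ) i = true).card : ℝ)
      + (Finset.univ.filter fun τ : Fin m => w (t - τ) i = false).card = m := by exact_mod_cast h1
    linarith
  obtain ⟨G, hGs, hG⟩ := exists_subset_card_eq_one_sub_mul hint hα hgood
  have hclose : ∀ τ ∈ G, ‖g (t - τ) i - honest i (x t)‖ ≤ L * (((m : ℝ) - 1) * γ) := by
    intro τ hτ
    have hw := (Finset.mem_filter.1 (hGs hτ)).2
    have hτm := τ.2
    rw [hr.feedback (t - τ) (by omega) (by omega) i hw]
    refine (hhon i _ _).trans (mul_le_mul_of_nonneg_left ?_ hL)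
    have h2 := hr.norm_drift_le hγ (show 1 ≤ t - (τ : ℕ) by omega) τ (by omega)
    rw [Nat.sub_add_cancel (by omega), norm_sub_rev] at h2
    refine h2.trans (mul_le_mul_of_nonneg_right ?_ hγ)
    have h3 : ((τ : ℕ) : ℝ) + 1 ≤ m := by exact_mod_cast hτm
    linarith
  have h1 := (hr.temporal t (by omega) hH (by omega) i).norm_sub_mean_le hα0 hα hm hG hclose
  have h2 : ‖(1 / ((1 - α₁) * m)) • ∑ τ ∈ G, g (t - τ) i - honest i (x t)‖
      ≤ L * (((m : ℝ) - 1) * γ) := by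
    rw [mean_sub (v := fun τ : Fin m => g (t - τ) i) (by linarith) hm hG]
    exact norm_mean_le (by linarith) hm hG hclose
  have h3 := norm_sub_le_norm_sub_add_norm_sub (ghat t i)
    ((1 / ((1 - α₁) * m)) • ∑ τ ∈ G, g (t - τ) i) (honest i (x t))
  linarith

/-- Error of the aggregate in a round in which robust aggregation does not fail. -/
theorem norm_agg_sub_le (hr : IsRangeRun m H α₁ α₂ γ x₁ honest w g ghat agg x) (hγ : 0 ≤ γ)
    (hL : 0 ≤ L) (hα0 : 0 ≤ α₁) (hα : α₁ < 1 / 2) (hint : ∃ n : ℕ, α₁ * m = n)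
    (hβ0 : 0 ≤ α₂) (hβ : α₂ < 1 / 2) (hint' : ∃ n : ℕ, α₂ * N = n) (hm : 1 ≤ m) (hN : 1 ≤ N)
    (hhon : ∀ i x y, ‖honest i x - honest i y‖ ≤ L * ‖x - y‖) {t r : ℕ} (hr1 : 1 ≤ r)
    (hrt : r + m = t + 1) (hH : t ≤ H)
    (hok : ¬ AggregationFails α₁ α₂ fun (τ : Fin m) i => w (r + τ) i)
    {y : EuclideanSpace ℝ (Fin d)} {A E : ℝ}
    (hA : ‖(1 / (N : ℝ)) • ∑ i, (honest i (x t) - y)‖ ≤ A)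
    (hE : ∀ i, ‖honest i (x t) - y‖ ≤ E) :
    ‖agg t - y‖ ≤ (1 + Calpha d α₂) * ((Calpha d α₁ + 1) * (L * (((m : ℝ) - 1) * γ)))
      + 2 * A + 2 * Calpha d α₂ * E := by
  classical
  have hgood : (1 - α₂) * N ≤ ((Finset.univ.filter fun i =>
      ¬ TemporalFails α₁ fun τ : Fin m => w (r + τ) i).card : ℝ) := by
    have h1 := Finset.card_filter_add_card_filter_not (s := (Finset.univ : Finset (Fin N)))
      (fun i => TemporalFails α₁ fun τ : Fin m => w (r + τ) i)
    simp only [Finset.card_univ, Fintype.card_fin] at h1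
    unfold AggregationFails at hok
    rw [not_lt] at hok
    have h2 : ((Finset.univ.filter fun i =>
        TemporalFails α₁ fun τ : Fin m => w (r + τ) i).card : ℝ)
      + (Finset.univ.filter fun i =>
        ¬ TemporalFails α₁ fun τ : Fin m => w (r + τ) i).card = N := by exact_mod_cast h1
    have h3 : ((Finset.univ.filter fun i =>
        TemporalFails α₁ fun τ : Fin m => w (r + τ) i).card : ℝ) ≤ α₂ * N := by
      convert hok
    linarith
  obtain ⟨G, hGs, hG⟩ := exists_subset_card_eq_one_sub_mul hint' hβ hgood
  set Δ := (Calpha d α₁ + 1) * (L * (((m : ℝ) - 1) * γ)) with hΔ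
  have hghat : ∀ i ∈ G, ‖ghat t i - honest i (x t)‖ ≤ Δ := fun i hi =>
    hr.norm_ghat_sub_le hγ hL hα0 hα hint hm hhon hr1 hrt hH (Finset.mem_filter.1 (hGs hi)).2
  have hclose : ∀ i ∈ G, ‖ghat t i - y‖ ≤ Δ + E := fun i hi =>
    (norm_sub_le_norm_sub_add_norm_sub _ (honest i (x t)) _).trans
      (add_le_add (hghat i hi) (hE i))
  have h1 := (hr.aggregate t (by omega) hH).norm_sub_mean_le hβ0 hβ hN hG hclose
  have h2 : ‖(1 / ((1 - α₂) * N)) • ∑ i ∈ G, (ghat t i - honest i (x t))‖ ≤ Δ :=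
    norm_mean_le (by linarith) hN hG hghat
  -- Comparing with the mean over all agents keeps the full averaging in `A`; the single-agent error
  -- `E` enters only with the factor `Calpha d α₂`.
  have h3 : ‖(1 / ((1 - α₂) * N)) • ∑ i ∈ G, (honest i (x t) - y)‖
      ≤ 2 * A + Calpha d α₂ * E :=
    (norm_mean_subset_le hβ0 hβ hN hG hE).trans (by linarith)
  have h4 : agg t - y = (agg t - (1 / ((1 - α₂) * N)) • ∑ i ∈ G, ghat t i)
      + ((1 / ((1 - α₂) * N)) • ∑ i ∈ G, (ghat t i - honest i (x t))
        + (1 / ((1 - α₂) * N)) • ∑ i ∈ G, (honest i (x t) - y)) := by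
    have h5 := mean_sub (v := ghat t) (show α₂ < 1 by linarith) hN hG y
    have h6 : ∑ i ∈ G, (ghat t i - y) = ∑ i ∈ G, (ghat t i - honest i (x t))
        + ∑ i ∈ G, (honest i (x t) - y) := by
      rw [← Finset.sum_add_distrib]
      exact Finset.sum_congr rfl fun i _ => by abel
    rw [← smul_add, ← h6, ← h5]
    abel
  rw [h4]
  refine (norm_add_le _ _).trans ?_
  refine (add_le_add h1 ((norm_add_le _ _).trans (add_le_add h2 h3))).trans (le_of_eq ?_)
  ring

end IsRangeRun

end Run

/-! ### Failure probability of the aggregation along the Markov chains -/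

section Chain

theorem agentTrans_nonneg {pb pt : ℝ} (h0 : 0 < pb) (hlt : pb < pt) (h1 : pt < 1) (s t : Bool) :
    0 ≤ agentTrans pb pt s t := by
  cases s <;> cases t <;> simp only [agentTrans] <;> linarith

theorem IsUniformFailBound.nonneg {m m₀ N : ℕ} {α₁ α₂ pb pt P : ℝ}
    (hP : IsUniformFailBound m m₀ N α₁ α₂ pb pt P) (h0 : 0 < pb) (hlt : pb < pt) (h1 : pt < 1) :
    0 ≤ P := by
  refine le_trans ?_ (hP fun _ => false)
  unfold failProb
  refine Finset.sum_nonneg fun u _ => ?_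
  split_ifs
  · exact Finset.prod_nonneg fun k _ => Finset.prod_nonneg fun i _ =>
      agentTrans_nonneg h0 hlt h1 _ _
  · exact le_rfl

theorem pathProb_succ {n N : ℕ} (pb pt : ℝ) (u : Fin (n + 2) → Fin N → Bool) :
    pathProb pb pt u = pathProb pb pt (fun k => u k.castSucc) *
      ∏ i, agentTrans pb pt (u (Fin.last n).castSucc i) (u (Fin.last (n + 1)) i) := by
  unfold pathProb
  rw [Fin.prod_univ_castSucc]
  rfl

variable {Ω : Type*} {mΩ : MeasurableSpace Ω} {μ : Measure Ω} {N : ℕ}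
  {𝓕 : Filtration ℕ mΩ} {pb pt : ℝ} {W : ℕ → Ω → Fin N → Bool}

theorem IsAgentChain.integral_mul_indicator [IsProbabilityMeasure μ]
    (hW : IsAgentChain μ 𝓕 pb pt W) {t : ℕ} (ht : 1 ≤ t)
    (v : Fin N → Bool) {X : Ω → ℝ} (hX : Measurable[𝓕 t] X) {C : ℝ} (hC : ∀ ω, |X ω| ≤ C) :
    ∫ ω, X ω * (W (t + 1) ⁻¹' {v}).indicator (fun _ => (1 : ℝ)) ω ∂μ
      = ∫ ω, X ω * ∏ i, agentTrans pb pt (W t ω i) (v i) ∂μ := by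
  have hset : MeasurableSet (W (t + 1) ⁻¹' {v}) :=
    𝓕.le (t + 1) _ (hW.1 (t + 1) (measurableSet_singleton v))
  have hint : Integrable ((W (t + 1) ⁻¹' {v}).indicator (fun _ => (1 : ℝ))) μ :=
    (integrable_const _).indicator hset
  have h1 := condExp_stronglyMeasurable_mul_of_bound (𝓕.le t) (hX.stronglyMeasurable) hint C
    (Filter.Eventually.of_forall hC)
  rw [← integral_condExp (𝓕.le t)]
  refine integral_congr_ae ?_
  filter_upwards [h1, hW.2 t ht v] with ω h2 h3
  change (μ[X * (W (t + 1) ⁻¹' {v}).indicator (fun _ => (1 : ℝ)) | 𝓕 t]) ω = _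
  rw [h2, Pi.mul_apply, h3]

/-- Peel off the last transition: the earlier path and `Y` are known at time `s + n`, and on that
path the conditional transition probability is a constant. -/
theorem IsAgentChain.integral_path [IsProbabilityMeasure μ]
    (hW : IsAgentChain μ 𝓕 pb pt W) {s : ℕ} (hs : 1 ≤ s)
    {Y : Ω → ℝ} (hY : Measurable[𝓕 s] Y) {C : ℝ} (hC : ∀ ω, |Y ω| ≤ C) (n : ℕ)
    (u : Fin (n + 1) → Fin N → Bool) :
    ∫ ω, {ω | ∀ k : Fin (n + 1), W (s + k) ω = u k}.indicator Y ω ∂μ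
      = pathProb pb pt u * ∫ ω, (W s ⁻¹' {u 0}).indicator Y ω ∂μ := by
  induction n with
  | zero =>
    have h1 : {ω | ∀ k : Fin 1, W (s + k) ω = u k} = W s ⁻¹' {u 0} := by
      ext ω; simp
    rw [h1]
    simp [pathProb]
  | succ n ih =>
    set A : Set Ω := {ω | ∀ k : Fin (n + 1), W (s + k) ω = u k.castSucc} with hA
    have hAm : MeasurableSet[𝓕 (s + n)] A := by
      have : A = ⋂ k : Fin (n + 1), W (s + k) ⁻¹' {u k.castSucc} := by
        ext ω; simp [hA]
      rw [this]
      exact MeasurableSet.iInter fun k =>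
        𝓕.mono (by omega) _ (hW.1 (s + k) (measurableSet_singleton _))
    have hXm : Measurable[𝓕 (s + n)] (A.indicator Y) :=
      (hY.mono (𝓕.mono (by omega)) le_rfl).indicator hAm
    have hXC : ∀ ω, |A.indicator Y ω| ≤ C := fun ω => by
      by_cases h : ω ∈ A
      · simpa [h] using hC ω
      · simpa [h] using (abs_nonneg _).trans (hC ω)
    have h1 := hW.integral_mul_indicator (show 1 ≤ s + n by omega) (u (Fin.last (n + 1))) hXm hXC
    have h2 : ∀ ω, {ω | ∀ k : Fin (n + 2), W (s + k) ω = u k}.indicator Y ω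
        = A.indicator Y ω
          * (W (s + n + 1) ⁻¹' {u (Fin.last (n + 1))}).indicator (fun _ => (1 : ℝ)) ω := by
      intro ω
      have h3 : (∀ k : Fin (n + 2), W (s + k) ω = u k) ↔
          ω ∈ A ∧ W (s + n + 1) ω = u (Fin.last (n + 1)) := by
        rw [Fin.forall_fin_succ']
        rfl
      by_cases ha : ω ∈ A <;> by_cases hb : W (s + n + 1) ω = u (Fin.last (n + 1)) <;>
        simp [Set.indicator, h3, ha, hb]
    have h4 : ∀ ω, A.indicator Y ω * ∏ i, agentTrans pb pt (W (s + n) ω i) (u (Fin.last (n + 1)) i)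
        = (∏ i, agentTrans pb pt (u (Fin.last n).castSucc i) (u (Fin.last (n + 1)) i))
          * A.indicator Y ω := by
      intro ω
      by_cases ha : ω ∈ A
      · have h5 : W (s + n) ω = u (Fin.last n).castSucc := ha (Fin.last n)
        rw [h5, mul_comm]
      · simp [ha]
    simp_rw [h2, h1, h4]
    rw [integral_const_mul, hA, ih fun k => u k.castSucc, pathProb_succ, Fin.castSucc_zero]
    ring

variable {m m₀ : ℕ} {α₁ α₂ P : ℝ}

theorem IsAgentChain.measurableSet_fails (hW : IsAgentChain μ 𝓕 pb pt W) (r : ℕ) :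
    MeasurableSet {ω | AggregationFails α₁ α₂ fun (τ : Fin m) => W (r + τ) ω} := by
  have h1 : Measurable fun ω => fun (τ : Fin m) => W (r + τ) ω :=
    measurable_pi_lambda _ fun τ => (hW.1 (r + τ)).mono (𝓕.le _) le_rfl
  exact h1 (Set.toFinite {u | AggregationFails α₁ α₂ u}).measurableSet

/-- Conditionally on the past at time `s`, robust aggregation fails on the window starting at
`s + m₀` with probability at most `P`. -/
theorem IsAgentChain.integral_fails_le [IsProbabilityMeasure μ] (hW : IsAgentChain μ 𝓕 pb pt W)
    (hP : IsUniformFailBound m m₀ N α₁ α₂ pb pt P) {s : ℕ} (hs : 1 ≤ s)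
    {Y : Ω → ℝ} (hY : Measurable[𝓕 s] Y) {C : ℝ} (hY0 : ∀ ω, 0 ≤ Y ω) (hYC : ∀ ω, Y ω ≤ C) :
    ∫ ω, {ω | AggregationFails α₁ α₂ fun (τ : Fin m) => W (s + m₀ + τ) ω}.indicator Y ω ∂μ
      ≤ P * ∫ ω, Y ω ∂μ := by
  classical
  have hC : ∀ ω, |Y ω| ≤ C := fun ω => by rw [abs_of_nonneg (hY0 ω)]; exact hYC ω
  have hYint : Integrable Y μ := Integrable.of_bound
    (hY.mono (𝓕.le s) le_rfl).aestronglyMeasurable C (Filter.Eventually.of_forall hC)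
  set n := m₀ + m - 1 with hn
  set bad : (Fin (n + 1) → Fin N → Bool) → Prop := fun u =>
    AggregationFails α₁ α₂ (fun τ : Fin m => u ⟨m₀ + τ, by omega⟩) with hbad
  set E : (Fin (n + 1) → Fin N → Bool) → Set Ω :=
    fun u => {ω | ∀ k : Fin (n + 1), W (s + k) ω = u k} with hE
  have hEm : ∀ u, MeasurableSet (E u) := fun u => by
    have : E u = ⋂ k : Fin (n + 1), W (s + k) ⁻¹' {u k} := by
      ext ω; simp [hE]
    rw [this]
    exact MeasurableSet.iInter fun k => 𝓕.le _ _ (hW.1 (s + k) (measurableSet_singleton _))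
  have hWm : ∀ w, MeasurableSet (W s ⁻¹' {w}) := fun w =>
    𝓕.le _ _ (hW.1 s (measurableSet_singleton _))
  -- Exactly one trajectory `u` is realized at each `ω`. Grouping the trajectories by first state
  -- turns their probabilities into `failProb`.
  have h1 : ∀ ω, {ω | AggregationFails α₁ α₂ fun (τ : Fin m) => W (s + m₀ + τ) ω}.indicator Y ω
      = ∑ u, if bad u then (E u).indicator Y ω else 0 := by
    intro ω
    have h2 : ∀ u, (if bad u then (E u).indicator Y ω else 0)
        = if u = (fun k : Fin (n + 1) => W (s + k) ω) then (if bad u then Y ω else 0) else 0 := by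
      intro u
      have h3 : ω ∈ E u ↔ u = fun k : Fin (n + 1) => W (s + k) ω := by
        rw [funext_iff]
        exact forall_congr' fun k => eq_comm
      by_cases hu : u = fun k : Fin (n + 1) => W (s + k) ω
      · rw [Set.indicator_of_mem (h3.2 hu), if_pos hu]
      · rw [Set.indicator_of_notMem (fun h => hu (h3.1 h)), if_neg hu]
        simp
    rw [Finset.sum_congr rfl fun u _ => h2 u, Finset.sum_ite_eq' Finset.univ]
    simp only [Finset.mem_univ, if_true, hbad, Set.indicator, Set.mem_ofPred_eq, add_assoc]
  have hint : ∀ u, Integrable (fun ω => if bad u then (E u).indicator Y ω else 0) μ := fun u => by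
    by_cases hu : bad u
    · simpa [hu] using hYint.indicator (hEm u)
    · simp [hu]
  have h5 : ∀ u, ∫ ω, (if bad u then (E u).indicator Y ω else 0) ∂μ
      = ∑ w, (if u 0 = w ∧ bad u then pathProb pb pt u else 0)
        * ∫ ω, (W s ⁻¹' {w}).indicator Y ω ∂μ := by
    intro u
    by_cases hu : bad u
    · simp only [hu, if_true, and_true, ite_mul, zero_mul, Finset.sum_ite_eq, Finset.mem_univ]
      exact hW.integral_path hs hY hC n u
    · simp [hu]
  have h6 : ∑ w, ∫ ω, (W s ⁻¹' {w}).indicator Y ω ∂μ = ∫ ω, Y ω ∂μ := by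
    rw [← integral_finsetSum _ fun w _ => hYint.indicator (hWm w)]
    refine integral_congr_ae (Filter.Eventually.of_forall fun ω => ?_)
    simp [Set.indicator]
  simp_rw [h1]
  rw [integral_finsetSum _ fun u _ => hint u, Finset.sum_congr rfl fun u _ => h5 u,
    Finset.sum_comm, ← h6, Finset.mul_sum]
  refine Finset.sum_le_sum fun w _ => ?_
  rw [← Finset.sum_mul]
  refine mul_le_mul_of_nonneg_right ?_
    (integral_nonneg fun ω => Set.indicator_nonneg (fun ω _ => hY0 ω) ω)
  refine le_trans (le_of_eq ?_) (hP w)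
  unfold failProb
  exact Finset.sum_congr rfl fun u _ => by congr

end Chain

/-! ### Convergence of the algorithm -/

section Convergence

variable {d N : ℕ} {m m₀ T H : ℕ} {α₁ α₂ γ L P R : ℝ} {x₁ : EuclideanSpace ℝ (Fin d)}
  {F : EuclideanSpace ℝ (Fin d) → ℝ}

namespace IsRangeRun

variable {honest : Fin N → EuclideanSpace ℝ (Fin d) → EuclideanSpace ℝ (Fin d)}
  {w : ℕ → Fin N → Bool} {g ghat : ℕ → Fin N → EuclideanSpace ℝ (Fin d)}
  {agg x : ℕ → EuclideanSpace ℝ (Fin d)}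

theorem norm_sub_init_le (hr : IsRangeRun m H α₁ α₂ γ x₁ honest w g ghat agg x) (hγ : 0 ≤ γ)
    {t : ℕ} (h1 : 1 ≤ t) (hH : t ≤ H + 1) : ‖x t - x₁‖ ≤ H * γ := by
  have h2 := hr.norm_drift_le hγ le_rfl (t - 1) (by omega)
  rw [Nat.add_sub_cancel' h1, hr.init] at h2
  refine h2.trans (mul_le_mul_of_nonneg_right ?_ hγ)
  exact_mod_cast (show t - 1 ≤ H by omega)

open Classical in
/-- One round of the algorithm, whether or not robust aggregation fails in it. -/
theorem step_le (hr : IsRangeRun m H α₁ α₂ γ x₁ honest w g ghat agg x) (hγ : 0 ≤ γ)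
    (hL : 0 ≤ L) (hα0 : 0 ≤ α₁) (hα : α₁ < 1 / 2) (hint : ∃ n : ℕ, α₁ * m = n)
    (hβ0 : 0 ≤ α₂) (hβ : α₂ < 1 / 2) (hint' : ∃ n : ℕ, α₂ * N = n) (hm : 1 ≤ m) (hN : 1 ≤ N)
    (hhon : ∀ i x y, ‖honest i x - honest i y‖ ≤ L * ‖x - y‖) (hF : IsLSmooth L F)
    {A E : ℝ} (hR : H * γ ≤ R)
    (hA : ∀ x, ‖x - x₁‖ ≤ R → ‖(1 / (N : ℝ)) • ∑ i, (honest i x - gradient F x)‖ ≤ A)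
    (hE : ∀ i x, ‖x - x₁‖ ≤ R → ‖honest i x - gradient F x‖ ≤ E) {t r : ℕ} (hr1 : 1 ≤ r)
    (hrt : r + m = t + 1) (hH : t ≤ H) :
    γ * ‖gradient F (x t)‖ ≤ F (x t) - F (x (t + 1))
      + 2 * γ * (if AggregationFails α₁ α₂ fun (τ : Fin m) => w (r + τ)
          then ‖gradient F (x t)‖ else 0)
      + (2 * γ * ((1 + Calpha d α₂) * ((Calpha d α₁ + 1) * (L * (((m : ℝ) - 1) * γ)))
        + 2 * A + 2 * Calpha d α₂ * E) + L / 2 * γ ^ 2) := by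
  have hball : ‖x t - x₁‖ ≤ R := (hr.norm_sub_init_le hγ (by omega) (by omega)).trans hR
  have hA0 : 0 ≤ A := (norm_nonneg _).trans (hA _ hball)
  have hE0 : 0 ≤ E := (norm_nonneg _).trans (hE ⟨0, hN⟩ _ hball)
  have hC1 := Calpha_nonneg d hα0 hα
  have hC2 := Calpha_nonneg d hβ0 hβ
  have hm1 : (0 : ℝ) ≤ (m : ℝ) - 1 := by
    have : (1 : ℝ) ≤ m := by exact_mod_cast hm
    linarith
  split_ifs with hf
  -- Here `F` may rise by `γ‖∇F‖`, so `2γ‖∇F‖` is needed for `γ‖∇F‖` to remain bounded; hence `1 -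
  -- 2P` later.
  · have h1 := hr.ascent_le hγ hL hF (show 1 ≤ t by omega) hH
    have h2 : 0 ≤ 2 * γ * ((1 + Calpha d α₂) * ((Calpha d α₁ + 1) * (L * (((m : ℝ) - 1) * γ)))
        + 2 * A + 2 * Calpha d α₂ * E) := by positivity
    linarith
  · have h1 := hr.norm_agg_sub_le hγ hL hα0 hα hint hβ0 hβ hint' hm hN hhon hr1 hrt hH hf
      (hA _ hball) fun i => hE i _ hball
    have h2 := hr.descent_of_norm_sub_le hγ hL hF (by omega) hH h1
    linarith

end IsRangeRun

variable {Ω : Type*} {mΩ : MeasurableSpace Ω} {μ : Measure Ω} [IsProbabilityMeasure μ]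
  {𝓕 : Filtration ℕ mΩ} {pb pt : ℝ} {W : ℕ → Ω → Fin N → Bool}
  {honest : Ω → Fin N → EuclideanSpace ℝ (Fin d) → EuclideanSpace ℝ (Fin d)}
  {g ghat : ℕ → Fin N → Ω → EuclideanSpace ℝ (Fin d)}
  {agg x : ℕ → Ω → EuclideanSpace ℝ (Fin d)}

theorem IsLSmooth.continuous_gradient {F : EuclideanSpace ℝ (Fin d) → ℝ} (hL : 0 ≤ L)
    (hF : IsLSmooth L F) : Continuous (gradient F) :=
  (LipschitzWith.of_dist_le_mul (K := L.toNNReal) fun x y => by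
    simpa [dist_eq_norm, Real.coe_toNNReal L hL] using hF.2 x y).continuous

theorem IsLSmooth.norm_gradient_le (hF : IsLSmooth L F) (x y : EuclideanSpace ℝ (Fin d)) :
    ‖gradient F x‖ ≤ ‖gradient F y‖ + L * ‖x - y‖ := by
  have h1 := hF.2 x y
  have h2 := norm_le_norm_add_norm_sub' (gradient F x) (gradient F y)
  linarith

/-- The telescoped expectation of `IsRangeRun.step_le` over the last `T` rounds, with the failure
term already absorbed on the left. -/
theorem sum_integral_norm_gradient_le (hγ : 0 ≤ γ) (hL : 0 ≤ L)
    (hα0 : 0 ≤ α₁) (hα : α₁ < 1 / 2) (hint : ∃ n : ℕ, α₁ * m = n)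
    (hβ0 : 0 ≤ α₂) (hβ : α₂ < 1 / 2) (hint' : ∃ n : ℕ, α₂ * N = n) (hm : 1 ≤ m) (hN : 1 ≤ N)
    (hT : 1 ≤ T) (hP0 : 0 ≤ P) (hP : IsUniformFailBound m m₀ N α₁ α₂ pb pt P)
    (hF : IsLSmooth L F) (hbdd : BddBelow (Set.range F)) (hW : IsAgentChain μ 𝓕 pb pt W)
    (hhon : ∀ ω i x y, ‖honest ω i x - honest ω i y‖ ≤ L * ‖x - y‖)
    (hrun : ∀ ω, IsRangeRun m (T + m - 1 + m₀) α₁ α₂ γ x₁ (honest ω) (fun t => W t ω)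
      (fun t i => g t i ω) (fun t i => ghat t i ω) (fun t => agg t ω) (fun t => x t ω))
    (hx : ∀ t, 1 ≤ t → t ≤ T + m - 1 + m₀ → Measurable[𝓕 t] (x t))
    {A E : Ω → ℝ} (hAi : Integrable A μ) (hEi : Integrable E μ)
    (hR : ((T + m - 1 + m₀ : ℕ) : ℝ) * γ ≤ R)
    (hA : ∀ ω x, ‖x - x₁‖ ≤ R → ‖(1 / (N : ℝ)) • ∑ i, (honest ω i x - gradient F x)‖ ≤ A ω)
    (hE : ∀ ω i x, ‖x - x₁‖ ≤ R → ‖honest ω i x - gradient F x‖ ≤ E ω) :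
    (∀ t, 1 ≤ t → t ≤ T + m - 1 + m₀ → Integrable (fun ω => ‖gradient F (x t ω)‖) μ) ∧
    (1 - 2 * P) * γ * ∑ k ∈ Finset.range T, ∫ ω, ‖gradient F (x (m + m₀ + k) ω)‖ ∂μ
      ≤ F x₁ - (⨅ y, F y) + ‖gradient F x₁‖ * (((m : ℝ) - 1 + m₀) * γ)
        + L / 2 * (((m : ℝ) - 1 + m₀) * γ) ^ 2
        + T * (4 * γ * P * (L * (((m : ℝ) - 1 + m₀) * γ))
          + (2 * γ * ((1 + Calpha d α₂) * ((Calpha d α₁ + 1) * (L * (((m : ℝ) - 1) * γ)))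
            + 2 * ∫ ω, A ω ∂μ + 2 * Calpha d α₂ * ∫ ω, E ω ∂μ) + L / 2 * γ ^ 2)) := by
  classical
  set H := T + m - 1 + m₀ with hHdef
  have hcast : ((m - 1 + m₀ : ℕ) : ℝ) = (m : ℝ) - 1 + m₀ := by
    rw [Nat.cast_add, Nat.cast_sub hm, Nat.cast_one]
  set n : ℝ := (m : ℝ) - 1 + m₀ with hn
  have hn0 : 0 ≤ n := hcast ▸ Nat.cast_nonneg _
  have hnγ : 0 ≤ L * (n * γ) := by positivity
  have hgm : ∀ t, 1 ≤ t → t ≤ H → Measurable[𝓕 t] fun ω => ‖gradient F (x t ω)‖ :=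
    fun t h1 h2 => ((hF.continuous_gradient hL).norm.measurable).comp (hx t h1 h2)
  have hgb : ∀ t, 1 ≤ t → t ≤ H → ∀ ω, ‖gradient F (x t ω)‖ ≤ ‖gradient F x₁‖ + L * R := by
    intro t h1 h2 ω
    refine (hF.norm_gradient_le _ x₁).trans ?_
    gcongr
    exact ((hrun ω).norm_sub_init_le hγ h1 (by omega)).trans hR
  have hgi : ∀ t, 1 ≤ t → t ≤ H → Integrable (fun ω => ‖gradient F (x t ω)‖) μ :=
    fun t h1 h2 => Integrable.of_bound ((hgm t h1 h2).mono (𝓕.le t) le_rfl).aestronglyMeasurable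
      (‖gradient F x₁‖ + L * R) (Filter.Eventually.of_forall fun ω => by
        rw [norm_norm]; exact hgb t h1 h2 ω)
  refine ⟨hgi, ?_⟩
  set Z : ℕ → Set Ω := fun k =>
    {ω | AggregationFails α₁ α₂ fun (τ : Fin m) => W (k + 1 + m₀ + τ) ω} with hZ
  have hZm : ∀ k, MeasurableSet (Z k) := fun k => hW.measurableSet_fails _
  set Y : ℕ → Ω → ℝ := fun k ω => ‖gradient F (x (m + m₀ + k) ω)‖ with hY
  have hYi : ∀ k < T, Integrable (Y k) μ := fun k hk => hgi _ (by omega) (by omega)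
  have hdrift : ∀ k < T, ∀ ω, ‖x (m + m₀ + k) ω - x (k + 1) ω‖ ≤ n * γ := by
    intro k hk ω
    have h1 := (hrun ω).norm_drift_le hγ (show 1 ≤ k + 1 by omega) (m - 1 + m₀) (by omega)
    rw [hcast, show k + 1 + (m - 1 + m₀) = m + m₀ + k by omega] at h1
    exact h1
  -- Round `m + m₀ + k` is compared with round `k + 1`, at which the state is conditioned on.
  -- Smoothness costs `L n γ` before conditioning and again when returning.
  have hZY : ∀ k < T, ∫ ω, (Z k).indicator (Y k) ω ∂μ
      ≤ P * (∫ ω, Y k ω ∂μ + 2 * (L * (n * γ))) := by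
    intro k hk
    have hs := hgi (k + 1) (by omega) (by omega)
    have h1 := hW.integral_fails_le hP (s := k + 1) (by omega)
      (Y := fun ω => ‖gradient F (x (k + 1) ω)‖ + L * (n * γ))
      ((hgm (k + 1) (by omega) (by omega)).add_const _) (fun ω => by positivity)
      (fun ω => add_le_add_left (hgb (k + 1) (by omega) (by omega) ω) _)
    have h2 : ∫ ω, (Z k).indicator (Y k) ω ∂μ ≤ ∫ ω, (Z k).indicator
        (fun ω => ‖gradient F (x (k + 1) ω)‖ + L * (n * γ)) ω ∂μ := by
      refine integral_mono ((hYi k hk).indicator (hZm k))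
        ((hs.add (integrable_const _)).indicator (hZm k)) fun ω => ?_
      refine Set.indicator_le_indicator ?_
      refine (hF.norm_gradient_le _ (x (k + 1) ω)).trans ?_
      gcongr
      exact hdrift k hk ω
    refine h2.trans (h1.trans (mul_le_mul_of_nonneg_left ?_ hP0))
    have h3 : ∫ ω, (‖gradient F (x (k + 1) ω)‖ + L * (n * γ)) ∂μ
        ≤ ∫ ω, (Y k ω + 2 * (L * (n * γ))) ∂μ := by
      refine integral_mono (hs.add (integrable_const _))
        ((hYi k hk).add (integrable_const _)) fun ω => ?_
      have h4 := hF.norm_gradient_le (x (k + 1) ω) (x (m + m₀ + k) ω)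
      have h5 := hdrift k hk ω
      rw [norm_sub_rev] at h5
      have h6 := mul_le_mul_of_nonneg_left h5 hL
      simp only [hY]
      linarith
    refine h3.trans (le_of_eq ?_)
    rw [integral_add (hYi k hk) (integrable_const _)]
    simp
  set e : Ω → ℝ := fun ω =>
    2 * γ * ((1 + Calpha d α₂) * ((Calpha d α₁ + 1) * (L * (((m : ℝ) - 1) * γ)))
      + 2 * A ω + 2 * Calpha d α₂ * E ω) + L / 2 * γ ^ 2 with he
  have hei : Integrable e μ :=
    (((((integrable_const _).add (hAi.const_mul 2)).add
      (hEi.const_mul (2 * Calpha d α₂))).const_mul (2 * γ))).add (integrable_const _)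
  have heint : ∫ ω, e ω ∂μ =
      2 * γ * ((1 + Calpha d α₂) * ((Calpha d α₁ + 1) * (L * (((m : ℝ) - 1) * γ)))
      + 2 * ∫ ω, A ω ∂μ + 2 * Calpha d α₂ * ∫ ω, E ω ∂μ) + L / 2 * γ ^ 2 := by
    have h1 : Integrable (fun ω => (1 + Calpha d α₂) * ((Calpha d α₁ + 1) *
        (L * (((m : ℝ) - 1) * γ))) + 2 * A ω) μ := (integrable_const _).add (hAi.const_mul 2)
    have h2 : Integrable (fun ω => 2 * Calpha d α₂ * E ω) μ := hEi.const_mul _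
    have h3 : Integrable (fun ω => (1 + Calpha d α₂) * ((Calpha d α₁ + 1) *
        (L * (((m : ℝ) - 1) * γ))) + 2 * A ω + 2 * Calpha d α₂ * E ω) μ := h1.add h2
    simp only [he]
    rw [integral_add (h3.const_mul _) (integrable_const _), integral_const_mul,
      integral_add h1 h2, integral_add (integrable_const _) (hAi.const_mul 2)]
    simp [integral_const_mul]
  set B : ℝ := F x₁ - (⨅ y, F y) + ‖gradient F x₁‖ * (n * γ) + L / 2 * (n * γ) ^ 2 with hB
  have hpoint : ∀ ω, ∑ k ∈ Finset.range T, γ * Y k ω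
      ≤ B + ∑ k ∈ Finset.range T, (2 * γ * (Z k).indicator (Y k) ω + e ω) := by
    intro ω
    have h1 : ∀ k ∈ Finset.range T, γ * Y k ω ≤
        (F (x (m + m₀ + k) ω) - F (x (m + m₀ + (k + 1)) ω))
          + (2 * γ * (Z k).indicator (Y k) ω + e ω) := by
      intro k hk
      have hk' := Finset.mem_range.1 hk
      have h2 := (hrun ω).step_le hγ hL hα0 hα hint hβ0 hβ hint' hm hN (hhon ω) hF hR (hA ω)
        (hE ω) (t := m + m₀ + k) (r := k + 1 + m₀) (by omega) (by omega) (by omega)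
      refine h2.trans (le_of_eq ?_)
      simp only [hZ, Set.indicator, Set.mem_ofPred_eq, hY, he]
      exact add_assoc _ _ _
    refine (Finset.sum_le_sum h1).trans ?_
    rw [Finset.sum_add_distrib, Finset.sum_range_sub' (fun k => F (x (m + m₀ + k) ω))]
    gcongr
    have h3 : (⨅ y, F y) ≤ F (x (m + m₀ + T) ω) := ciInf_le hbdd _
    -- The sum starts at `m + m₀`, not at `1`; a Taylor expansion at `x₁` pays for the initial
    -- rounds and produces the `O(1/T)` term.
    have h4 := (abs_le.1 (hF.abs_taylor_le x₁ (x (m + m₀ + 0) ω))).2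
    have h5 : ‖x (m + m₀ + 0) ω - x₁‖ ≤ n * γ := by
      have := hdrift 0 (by omega) ω
      rwa [zero_add, (hrun ω).init] at this
    have h6 : inner ℝ (gradient F x₁) (x (m + m₀ + 0) ω - x₁) ≤ ‖gradient F x₁‖ * (n * γ) :=
      (real_inner_le_norm _ _).trans (mul_le_mul_of_nonneg_left h5 (norm_nonneg _))
    have h7 : L / 2 * ‖x (m + m₀ + 0) ω - x₁‖ ^ 2 ≤ L / 2 * (n * γ) ^ 2 := by gcongr
    rw [hB]
    linarith
  have hint1 : ∀ k ∈ Finset.range T, Integrable (fun ω => γ * Y k ω) μ := fun k hk =>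
    (hYi k (Finset.mem_range.1 hk)).const_mul γ
  have hint2 : ∀ k ∈ Finset.range T,
      Integrable (fun ω => 2 * γ * (Z k).indicator (Y k) ω + e ω) μ := fun k hk =>
    (((hYi k (Finset.mem_range.1 hk)).indicator (hZm k)).const_mul _).add hei
  have hI := integral_mono (integrable_finsetSum _ hint1)
    ((integrable_const B).add (integrable_finsetSum _ hint2)) hpoint
  have e1 : ∫ ω, ∑ k ∈ Finset.range T, γ * Y k ω ∂μ
      = γ * ∑ k ∈ Finset.range T, ∫ ω, Y k ω ∂μ := by
    rw [integral_finsetSum _ hint1, Finset.mul_sum]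
    exact Finset.sum_congr rfl fun k _ => integral_const_mul _ _
  have e2 : ∫ ω, (B + ∑ k ∈ Finset.range T, (2 * γ * (Z k).indicator (Y k) ω + e ω)) ∂μ
      = B + ∑ k ∈ Finset.range T,
        (2 * γ * ∫ ω, (Z k).indicator (Y k) ω ∂μ + ∫ ω, e ω ∂μ) := by
    rw [integral_add (integrable_const _) (integrable_finsetSum _ hint2),
      integral_finsetSum _ hint2]
    congr 1
    · simp
    · refine Finset.sum_congr rfl fun k hk => ?_
      rw [integral_add (((hYi k (Finset.mem_range.1 hk)).indicator (hZm k)).const_mul _) hei,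
        integral_const_mul]
  have e3 : ∑ k ∈ Finset.range T, (2 * γ * ∫ ω, (Z k).indicator (Y k) ω ∂μ + ∫ ω, e ω ∂μ)
      ≤ ∑ k ∈ Finset.range T, (2 * γ * P * ∫ ω, Y k ω ∂μ
        + (4 * γ * P * (L * (n * γ)) + ∫ ω, e ω ∂μ)) := by
    refine Finset.sum_le_sum fun k hk => ?_
    have h1 := mul_le_mul_of_nonneg_left (hZY k (Finset.mem_range.1 hk))
      (show 0 ≤ 2 * γ by positivity)
    linarith
  have e4 : ∑ k ∈ Finset.range T, (2 * γ * P * ∫ ω, Y k ω ∂μ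
        + (4 * γ * P * (L * (n * γ)) + ∫ ω, e ω ∂μ))
      = 2 * γ * P * ∑ k ∈ Finset.range T, ∫ ω, Y k ω ∂μ
        + T * (4 * γ * P * (L * (n * γ)) + ∫ ω, e ω ∂μ) := by
    rw [Finset.sum_add_distrib, ← Finset.mul_sum, Finset.sum_const, Finset.card_range,
      nsmul_eq_mul]
  have hI' : γ * ∑ k ∈ Finset.range T, ∫ ω, Y k ω ∂μ ≤ B + ∑ k ∈ Finset.range T,
        (2 * γ * ∫ ω, (Z k).indicator (Y k) ω ∂μ + ∫ ω, e ω ∂μ) := by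
    rw [← e1, ← e2]; exact hI
  rw [← heint]
  change (1 - 2 * P) * γ * ∑ k ∈ Finset.range T, ∫ ω, Y k ω ∂μ
    ≤ B + T * (4 * γ * P * (L * (n * γ)) + ∫ ω, e ω ∂μ)
  linarith

end Convergence

/-! ### Division by the step size and collection of constants -/

section Bound

/-- From the summed descent inequality to the bound of the theorem. -/
theorem average_le_rangeBound {d m m₀ N b T : ℕ} {L γ₀ α₁ α₂ P gap G₁ K₀ Sg A E : ℝ}
    (hL : 0 ≤ L) (hγ₀ : 0 < γ₀) (hm : 1 ≤ m) (hT : 1 ≤ T) (hα0 : 0 ≤ α₁) (hα : α₁ < 1 / 2)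
    (hβ0 : 0 ≤ α₂) (hβ : α₂ < 1 / 2) (hP : P < 1 / 2)
    (hA : A ≤ K₀ * (1 + Real.log (T * N * b)) * (1 / √((N : ℝ) * b)))
    (hE : E ≤ K₀ * (1 + Real.log (T * N * b)) * (1 / √(b : ℝ)))
    (h : (1 - 2 * P) * (γ₀ / √(T : ℝ)) * Sg ≤ gap + G₁ * (((m : ℝ) - 1 + m₀) * (γ₀ / √(T : ℝ)))
        + L / 2 * (((m : ℝ) - 1 + m₀) * (γ₀ / √(T : ℝ))) ^ 2
        + T * (4 * (γ₀ / √(T : ℝ)) * P * (L * (((m : ℝ) - 1 + m₀) * (γ₀ / √(T : ℝ))))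
          + (2 * (γ₀ / √(T : ℝ)) * ((1 + Calpha d α₂) *
              ((Calpha d α₁ + 1) * (L * (((m : ℝ) - 1) * (γ₀ / √(T : ℝ)))))
            + 2 * A + 2 * Calpha d α₂ * E) + L / 2 * (γ₀ / √(T : ℝ)) ^ 2))) :
    1 / (T : ℝ) * Sg ≤ rangeBound d m m₀ N b T L γ₀ α₁ α₂ P gap G₁ (4 * K₀) := by
  have hC1 := Calpha_nonneg d hα0 hα
  have hC2 := Calpha_nonneg d hβ0 hβ
  have hT0 : (0 : ℝ) < T := by exact_mod_cast hT
  have hm1 : (0 : ℝ) ≤ (m : ℝ) - 1 := by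
    have : (1 : ℝ) ≤ m := by exact_mod_cast hm
    linarith
  have hs : 0 < √(T : ℝ) := Real.sqrt_pos.2 hT0
  have hss : (T : ℝ) = √(T : ℝ) ^ 2 := (Real.sq_sqrt hT0.le).symm
  have hq : 0 < 1 - 2 * P := by linarith
  set n : ℝ := (m : ℝ) - 1 + m₀ with hn
  set ℓ : ℝ := 1 + Real.log (T * N * b) with hℓ
  set C₁ := Calpha d α₁ with hC₁
  set C₂ := Calpha d α₂ with hC₂
  set s := √(T : ℝ) with hsdef
  set γ := γ₀ / s with hγdef
  have hγ : 0 < γ := div_pos hγ₀ hs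
  have hstat : 4 * A + 4 * C₂ * E
      ≤ 4 * K₀ * ℓ * (1 / √((N : ℝ) * b) + C₂ / √(b : ℝ)) := by
    have h1 := mul_le_mul_of_nonneg_left hE hC2
    have h2 : C₂ * (K₀ * ℓ * (1 / √(b : ℝ))) = K₀ * ℓ * (C₂ / √(b : ℝ)) := by ring
    rw [h2] at h1
    linarith
  -- The argument yields `C₂(C₁ + 1)` where the stated constant has twice that.
  have hdrift : 2 * ((1 + C₂) * ((C₁ + 1) * (L * (((m : ℝ) - 1) * γ))))
      ≤ 2 * ((m : ℝ) - 1) * (1 + C₁ + 2 * C₂ * (C₁ + 1)) * (L * γ) := by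
    have h1 : 0 ≤ C₂ * (C₁ + 1) * (((m : ℝ) - 1) * (L * γ)) := by positivity
    linarith
  have hmain : (1 - 2 * P) * γ * Sg ≤ gap + G₁ * (n * γ) + L / 2 * (n * γ) ^ 2
      + T * γ * (4 * K₀ * ℓ * (1 / √((N : ℝ) * b) + C₂ / √(b : ℝ))
        + (1 / 2 + 4 * n * P + 2 * ((m : ℝ) - 1) * (1 + C₁ + 2 * C₂ * (C₁ + 1))) * (L * γ)) := by
    have h1 := mul_le_mul_of_nonneg_left (add_le_add hstat hdrift)
      (show 0 ≤ T * γ by positivity)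
    linarith
  have hX : 1 / (T : ℝ) * Sg = (1 - 2 * P) * γ * Sg / (T * γ * (1 - 2 * P)) := by
    field_simp
  rw [hX]
  refine (div_le_div_of_nonneg_right hmain (by positivity)).trans (le_of_eq ?_)
  unfold rangeBound Cbar
  rw [← hn, ← hℓ, ← hsdef, ← hC₁, ← hC₂]
  clear_value ℓ n C₁ C₂
  generalize 1 / √((N : ℝ) * b) + C₂ / √(b : ℝ) = stat
  rw [hss, hγdef]
  clear_value s
  field_simp
  ring

end Bound

/-! ### The main theorem -/

theorem theorem2 (d : ℕ) (L σ a γ₀ : ℝ) (hL : 0 < L) (hσ : 0 ≤ σ) (ha : 0 ≤ a) (hγ₀ : 0 < γ₀)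
    (m m₀ : ℕ) (hm : 1 ≤ m) :
    -- the constant of the statistical error depends on `d, L, σ, a, γ₀, m, m₀` only
    ∃ K : ℝ, 0 ≤ K ∧
      ∀ (N b T : ℕ) (_ : 1 ≤ N) (_ : 1 ≤ b) (_ : 1 ≤ T)
        -- network and algorithm parameters
        (pb pt α₁ α₂ : ℝ) (_ : 0 < pb) (_ : pb < pt) (_ : pt < 1)
        (_ : 0 ≤ α₁) (_ : α₁ < 1 / 2) (_ : ∃ n : ℕ, α₁ * m = n)
        (_ : 0 ≤ α₂) (_ : α₂ < 1 / 2) (_ : ∃ n : ℕ, α₂ * N = n)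
        (P : ℝ) (_ : IsUniformFailBound m m₀ N α₁ α₂ pb pt P) (_ : P < 1 / 2)
        -- the cost function and the data distribution
        (S : Type*) [MeasurableSpace S] (D : Measure S) [IsProbabilityMeasure D]
        (f : EuclideanSpace ℝ (Fin d) → S → ℝ)
        (_ : ∀ x, Integrable (f x) D)
        (_ : ∀ z, IsLSmooth L (fun x => f x z))
        (_ : HasSubGammaNoise D σ a f)
        (_ : BddBelow (Set.range (risk D f)))
        -- the fixed samples `z i j` of the agents, and their states
        (Ω : Type*) [mΩ : MeasurableSpace Ω] (μ : Measure Ω) [IsProbabilityMeasure μ]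
        (z : Fin N → Fin b → Ω → S)
        (_ : ∀ i j, Measurable (z i j)) (_ : ∀ i j, μ.map (z i j) = D)
        (_ : iIndepFun (fun p : Fin N × Fin b => z p.1 p.2) μ)
        (𝓕 : Filtration ℕ mΩ) (W : ℕ → Ω → Fin N → Bool)
        (_ : IsAgentChain μ 𝓕 pb pt W)
        (_ : IndepFun (fun ω i j => z i j ω) (fun ω t => W t ω) μ)
        -- a run of the algorithm against an arbitrary adversary without foresight
        (x₁ : EuclideanSpace ℝ (Fin d))
        (g ghat : ℕ → Fin N → Ω → EuclideanSpace ℝ (Fin d))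
        (agg x : ℕ → Ω → EuclideanSpace ℝ (Fin d))
        (_ : ∀ ω, IsRangeRun m (T + m - 1 + m₀) α₁ α₂ (γ₀ / √(T : ℝ)) x₁
          (fun i => gradient (empiricalRisk f (fun j => z i j ω)))
          (fun t => W t ω) (fun t i => g t i ω) (fun t i => ghat t i ω)
          (fun t => agg t ω) (fun t => x t ω))
        (_ : ∀ t, 1 ≤ t → t ≤ T + m - 1 + m₀ → Measurable[𝓕 t] (x t)),
        (∀ t ∈ Finset.Icc (m + m₀) (T + m - 1 + m₀),
          Integrable (fun ω => ‖gradient (risk D f) (x t ω)‖) μ) ∧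
        (1 / (T : ℝ)) * ∑ t ∈ Finset.Icc (m + m₀) (T + m - 1 + m₀),
            ∫ ω, ‖gradient (risk D f) (x t ω)‖ ∂μ
          ≤ rangeBound d m m₀ N b T L γ₀ α₁ α₂ P
              (risk D f x₁ - ⨅ y, risk D f y) ‖gradient (risk D f) x₁‖ K ∧
        ∃ t ∈ Finset.Icc (m + m₀) (T + m - 1 + m₀),
          ∫ ω, ‖gradient (risk D f) (x t ω)‖ ∂μ
            ≤ rangeBound d m m₀ N b T L γ₀ α₁ α₂ P
                (risk D f x₁ - ⨅ y, risk D f y) ‖gradient (risk D f) x₁‖ K := by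
  have hρ : 0 ≤ γ₀ * (1 + m + m₀) := by positivity
  refine ⟨4 * noiseConst d L σ a (γ₀ * (1 + m + m₀)),
    mul_nonneg (by norm_num) (noiseConst_nonneg hL.le ha hρ), ?_⟩
  intro N b T hN hb hT pb pt α₁ α₂ hpb hpbt hpt hα0 hα hαn hβ0 hβ hβn P hP hP2 S _ D _ f hf hfL
    hsg hbdd Ω mΩ μ _ z hz hzD hind 𝓕 W hW _ x₁ g ghat agg x hrun hx
  have : Nonempty (Fin N) := ⟨⟨0, hN⟩⟩
  have : Nonempty (Fin b) := ⟨⟨0, hb⟩⟩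
  have hN0 : (1 : ℝ) ≤ N := by exact_mod_cast hN
  have hb0 : (1 : ℝ) ≤ b := by exact_mod_cast hb
  have hT0 : (1 : ℝ) ≤ T := by exact_mod_cast hT
  have hNb : (1 : ℝ) ≤ (N : ℝ) * b := one_le_mul_of_one_le_of_one_le hN0 hb0
  have hγ : 0 ≤ γ₀ / √(T : ℝ) := by positivity
  set H := T + m - 1 + m₀ with hH
  set R : ℝ := (H : ℝ) * (γ₀ / √(T : ℝ)) with hR
  have hδ : 0 < 1 / √((N : ℝ) * b) := by positivity
  -- The ball of radius `Hγ` contains every iterate. With mesh `1/√(Nb)` its grid has side `O(TNb)`,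
  -- the source of `log (TNb)` and of the dependence of `K` on `γ₀`, `m`, `m₀`.
  have hRδ : R / (1 / √((N : ℝ) * b)) ≤ γ₀ * (1 + m + m₀) * ((T * N * b : ℕ) : ℝ) := by
    have h1 : (H : ℝ) ≤ (1 + m + m₀) * T := by
      have h2 : (H : ℝ) ≤ T + m + m₀ := by exact_mod_cast (show H ≤ T + m + m₀ by omega)
      have h3 : (0 : ℝ) ≤ m := Nat.cast_nonneg m
      have h4 : (0 : ℝ) ≤ m₀ := Nat.cast_nonneg m₀
      nlinarith
    have h2 : R ≤ γ₀ * (1 + m + m₀) * T := by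
      have h3 : γ₀ / √(T : ℝ) ≤ γ₀ := div_le_self hγ₀.le (Real.one_le_sqrt.2 hT0)
      calc R ≤ (1 + m + m₀) * T * γ₀ := by rw [hR]; gcongr
        _ = _ := by ring
    have h5 : √((N : ℝ) * b) ≤ (N : ℝ) * b := Real.sqrt_le_iff.2 ⟨by linarith, by nlinarith⟩
    rw [div_div_eq_mul_div, div_one]
    push_cast
    calc R * √((N : ℝ) * b) ≤ γ₀ * (1 + m + m₀) * T * ((N : ℝ) * b) := by gcongr
      _ = _ := by ring
  have hcardb : Fintype.card (Fin b) = b := Fintype.card_fin b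
  have hcardNb : ((Fintype.card (Fin N × Fin b) : ℕ) : ℝ) = (N : ℝ) * b := by simp
  have hRnn : 0 ≤ R := by positivity
  -- One group of all `Nb` samples for the pooled noise `A`; next, `N` groups of `b` samples for the
  -- worst single agent `E`, on the same grid.
  obtain ⟨A, hAi, hA, hAle⟩ := exists_noise_envelope (μ := μ) (κ := Unit) (ι := Fin N × Fin b)
    (ζ := fun _ p => z p.1 p.2) hL.le ha hf hfL hsg (fun _ p => hz p.1 p.2)
    (fun _ p => hzD p.1 p.2) (fun _ => hind) x₁ (Q := T * N * b) hRnn hδ hρ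
    (by rw [Fintype.card_unit]; exact Nat.mul_pos (Nat.mul_pos hT hN) hb) hRδ (by rw [hcardNb])
  obtain ⟨E, hEi, hE, hEle⟩ := exists_noise_envelope (μ := μ) (κ := Fin N) (ι := Fin b)
    (ζ := z) hL.le ha hf hfL hsg hz hzD
    (fun i => hind.precomp (g := fun j : Fin b => (i, j)) fun _ _ h => (Prod.mk.inj h).2) x₁
    (Q := T * N * b) hRnn hδ hρ
    (by
      rw [Fintype.card_fin, mul_right_comm]
      exact Nat.le_mul_of_pos_left N (Nat.mul_pos hT hb)) hRδ
    (by
      rw [Fintype.card_fin]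
      exact one_div_le_one_div_of_le (by positivity)
        (Real.sqrt_le_sqrt (le_mul_of_one_le_left (by linarith) hN0)))
  rw [hcardNb] at hAle
  rw [hcardb] at hEle
  push_cast at hAle hEle
  set honest : Ω → Fin N → EuclideanSpace ℝ (Fin d) → EuclideanSpace ℝ (Fin d) :=
    fun ω i => gradient (empiricalRisk f fun j => z i j ω) with hhonest
  have hdev : ∀ ω i y, honest ω i y - gradient (risk D f) y
      = gradNoise D f (fun j => z i j ω) y := fun ω i y => by
    simp only [hhonest, gradNoise, gradient_empiricalRisk hfL, Fintype.card_fin]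
    rw [Finset.sum_sub_distrib, smul_sub, Finset.sum_const, Finset.card_univ, Fintype.card_fin,
      ← Nat.cast_smul_eq_nsmul ℝ, smul_smul, one_div_mul_cancel (by positivity), one_smul]
  have hdevmean : ∀ ω y, (1 / (N : ℝ)) • ∑ i, (honest ω i y - gradient (risk D f) y)
      = gradNoise D f (fun p : Fin N × Fin b => z p.1 p.2 ω) y := fun ω y => by
    simp only [hdev, gradNoise, Fintype.card_fin, hcardNb]
    rw [← Finset.smul_sum, smul_smul, Fintype.sum_prod_type, one_div_mul_one_div]
  have hhonL : ∀ ω i y y', ‖honest ω i y - honest ω i y'‖ ≤ L * ‖y - y'‖ := fun ω i y y' => by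
    simp only [hhonest, gradient_empiricalRisk hfL]
    rw [← smul_sub, ← Finset.sum_sub_distrib, norm_smul, Real.norm_of_nonneg (by positivity),
      one_div, inv_mul_le_iff₀ (by positivity)]
    refine (norm_sum_le_of_le _ fun j _ => (hfL (z i j ω)).2 y y').trans (le_of_eq ?_)
    simp
  obtain ⟨hgi, hsum⟩ := sum_integral_norm_gradient_le (μ := μ) (honest := honest) (R := R) hγ hL.le
    hα0 hα hαn hβ0 hβ hβn hm hN hT (hP.nonneg hpb hpbt hpt) hP (isLSmooth_risk hf hfL) hbdd hW
    hhonL hrun hx hAi hEi le_rfl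
    (fun ω y hy => by rw [hdevmean]; exact hA ω () y hy)
    (fun ω i y hy => by rw [hdev]; exact hE ω i y hy)
  have hIcc : ∑ t ∈ Finset.Icc (m + m₀) H, ∫ ω, ‖gradient (risk D f) (x t ω)‖ ∂μ
      = ∑ k ∈ Finset.range T, ∫ ω, ‖gradient (risk D f) (x (m + m₀ + k) ω)‖ ∂μ := by
    have h1 : Finset.Icc (m + m₀) H = Finset.Ico (m + m₀) (m + m₀ + T) := by
      ext t; simp only [Finset.mem_Icc, Finset.mem_Ico]; omega
    rw [h1, Finset.sum_Ico_eq_sum_range, Nat.add_sub_cancel_left]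
  have hbound : 1 / (T : ℝ) * ∑ t ∈ Finset.Icc (m + m₀) H,
      ∫ ω, ‖gradient (risk D f) (x t ω)‖ ∂μ ≤ rangeBound d m m₀ N b T L γ₀ α₁ α₂ P
        (risk D f x₁ - ⨅ y, risk D f y) ‖gradient (risk D f) x₁‖
        (4 * noiseConst d L σ a (γ₀ * (1 + m + m₀))) := by
    rw [hIcc]
    exact average_le_rangeBound hL.le hγ₀ hm hT hα0 hα hβ0 hβ hP2 hAle hEle hsum
  refine ⟨fun t ht => ?_, hbound, ?_⟩
  · rw [Finset.mem_Icc] at ht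
    exact hgi t (by omega) ht.2
  · by_contra! hne
    have hcard : (Finset.Icc (m + m₀) H).card = T := by rw [Nat.card_Icc]; omega
    have hnonempty : (Finset.Icc (m + m₀) H).Nonempty :=
      Finset.card_pos.1 (by rw [hcard]; exact hT)
    have h1 := Finset.sum_lt_sum_of_nonempty hnonempty hne
    rw [Finset.sum_const, hcard, nsmul_eq_mul] at h1
    have h2 := (mul_lt_mul_iff_right₀ (show 0 < 1 / (T : ℝ) by positivity)).2 h1
    rw [← mul_assoc, one_div_mul_cancel (by positivity), one_mul] at h2
    exact absurd hbound (not_le.2 h2)
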